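/- Let $\rho,\mu,\nu$ be probability measures on $\mathbb{R}^d$ with finite second moments and let $\varepsilon>0$. *Definitions.* For a probability measure $\rho$ and $\phi:\mathbb{R}^d\to[-\infty,+\infty]$ put $\Phi_\varepsilon^\rho[\phi](z)=\varepsilon\log\int e^{(\langle x,z\rangle-\phi(x))/\varepsilon}\,d\rho(x)\in[-\infty,+\infty]$ for $z\in\mathbb{R}^d$. A pair of entropic Brenier potentials between $\rho$ and $\nu$ is a pair of extended-real functions on $\mathbb{R}^d$ of the form $\psi_\varepsilon^\nu=\Phi_\varepsilon^\rho[\phi_0]$, $\phi_\varepsilon^\nu=\Phi_\varepsilon^\nu[\psi_\varepsilon^\nu]$, where $\phi_0$ minimizes the dual entropic optimal transport objective $\phi\mapsto\int\phi\,d\rho+\int\Phi_\varepsilon^\rho[\phi]\,d\nu$ over $L^1(\rho)$. With $\gamma_\varepsilon^\nu(x,z)=e^{(\langle x,z\rangle-\phi_\varepsilon^\nu(x)-\psi_\varepsilon^\nu(z))/\varepsilon}$, the conditional laws of the entropic coupling are $d\pi_\varepsilon^\nu(z|x)=\gamma_\varepsilon^\nu(x,z)\,d\nu(z)$ for $x$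 with $\phi_\varepsilon^\nu(x)<\infty$ and $d\pi_\varepsilon^\nu(x|z)=\gamma_\varepsilon^\nu(x,z)\,d\rho(x)$ for $z$ with $\psi_\varepsilon^\nu(z)<\infty$. The forward and backward entropic Brenier maps are $$T_\varepsilon^\nu(x)=\int z\,d\pi_\varepsilon^\nu(z|x),\qquad S_\varepsilon^\nu(z)=\int x\,d\pi_\varepsilon^\nu(x|z),$$ at those of these points where the integral is well-defined. Replacing $\nu$ by $\mu$ defines $\phi_\varepsilon^\mu$, $\psi_\varepsilon^\mu$ and $T_\varepsilon^\mu$. Further, $W_2(\mu,\nu)^2=\inf_\pi\iint\|y-z\|^2\,d\pi(y,z)$, the infimum being over all couplings $\pi$ of $\mu$ and $\nu$. *Statement.* Suppose that $T_\varepsilon^\nu$ is defined on all of $\mathbb{R}^d$ and is $\Lambda$-Lipschitz there, for some $\Lambda\ge 0$. 1. If $\rho$ is supported in the ball $B(0;R)$, then $$\|T_\varepsilon^\mu-T_\varepsilon^\nu\|_{L^2(\rho)}\le\bigl(1+2\sqrt{\Lambda R^2/\varepsilon}\bigr)\,W_2(\mu,\nu).$$ 2. If instead (with no assumption on the support of $\rho$)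 $S_\varepsilon^\nu$ is defined on all of $\mathbb{R}^d$ and is $1/\lambda$-Lipschitz there, for some $\lambda>0$, then $$\|T_\varepsilon^\mu-T_\varepsilon^\nu\|_{L^2(\rho)}\le\bigl(1+2\sqrt{\Lambda/\lambda}\bigr)\,W_2(\mu,\nu).$$ -/

import Mathlib

open MeasureTheory
open scoped ENNReal NNReal RealInnerProductSpace

/-- `ℝ^d` with its Euclidean structure. -/
abbrev Eu (d : ℕ) : Type := EuclideanSpace ℝ (Fin d)

/-- `π ∈ Γ(μ, ν)`: the left marginal of `π` is `μ` and its right marginal is `ν`. -/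
def IsCoupling {d : ℕ} (π : Measure (Eu d × Eu d)) (μ ν : Measure (Eu d)) : Prop :=
  π.map Prod.fst = μ ∧ π.map Prod.snd = ν

/-- The `2`-Wasserstein distance, `W₂(μ, ν)² = inf_{π ∈ Γ(μ, ν)} ∬ ‖y - z‖² dπ(y, z)`. -/
noncomputable def wasserstein2 {d : ℕ} (μ ν : Measure (Eu d)) : ℝ≥0∞ :=
  (⨅ (π : Measure (Eu d × Eu d)) (_ : IsCoupling π μ ν),
    ∫⁻ p, ‖p.1 - p.2‖ₑ ^ 2 ∂π) ^ (1 / 2 : ℝ)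

/-- Integral of an extended-real function, as integral of the positive part minus integral of the
negative part. -/
noncomputable def erealIntegral {d : ℕ} (ν : Measure (Eu d)) (f : Eu d → EReal) : EReal :=
  ((∫⁻ z, (f z).toENNReal ∂ν : ℝ≥0∞) : EReal) - ((∫⁻ z, (-f z).toENNReal ∂ν : ℝ≥0∞) : EReal)

/-- The entropic conjugate `Φ_ε^ρ[φ](z) = ε log ∫ exp((⟨x, z⟩ - φ(x)) / ε) dρ(x)`, with values in
the extended reals. -/
noncomputable def entropicConj {d : ℕ} (ε : ℝ) (ρ : Measure (Eu d)) (φ : Eu d → EReal)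
    (z : Eu d) : EReal :=
  (ε : EReal) *
    ENNReal.log (∫⁻ x, EReal.exp ((((⟪x, z⟫ : ℝ) : EReal) - φ x) / (ε : EReal)) ∂ρ)

/-- The objective `∫ φ dρ + ∫ Φ_ε^ρ[φ] dν` of the dual entropic optimal transport problem. The
second integral never has an infinite negative part when `φ ∈ L¹(ρ)` and the probability measures
`ρ`, `ν` have finite first moment, by Jensen's inequality. -/
noncomputable def entropicDual {d : ℕ} (ε : ℝ) (ρ ν : Measure (Eu d)) (φ : Eu d → ℝ) : EReal :=
  ((∫ x, φ x ∂ρ : ℝ) : EReal) + erealIntegral ν (entropicConj ε ρ (fun x => (φ x : EReal)))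

/-- `φ` is a minimizer, over `L¹(ρ)`, of the dual entropic optimal transport problem between `ρ`
and `ν`. -/
def IsEntropicDualMinimizer {d : ℕ} (ε : ℝ) (ρ ν : Measure (Eu d)) (φ : Eu d → ℝ) : Prop :=
  Integrable φ ρ ∧
    ∀ φ' : Eu d → ℝ, Integrable φ' ρ → entropicDual ε ρ ν φ ≤ entropicDual ε ρ ν φ'

/-- `(φ, ψ)` is a pair of entropic Brenier potentials between `ρ` and `ν`, in the version that is
defined everywhere on `ℝ^d` with extended-real values: `ψ = Φ_ε^ρ[φ₀]` and `φ = Φ_ε^ν[ψ]` for a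
minimizer `φ₀` of the dual problem. (A minimizer `φ₀` is only determined `ρ`-almost everywhere, up
to an additive constant; `φ` is its extension to all of `ℝ^d`.) -/
def IsEntropicPotentials {d : ℕ} (ε : ℝ) (ρ ν : Measure (Eu d)) (φ ψ : Eu d → EReal) : Prop :=
  ∃ φ₀ : Eu d → ℝ, IsEntropicDualMinimizer ε ρ ν φ₀ ∧
    ψ = entropicConj ε ρ (fun x => (φ₀ x : EReal)) ∧ φ = entropicConj ε ν ψ

/-- The density `γ(x, z) = exp((⟨x, z⟩ - φ(x) - ψ(z)) / ε)` of the entropic coupling with respect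
to the product measure. -/
noncomputable def entropicDensity {d : ℕ} (ε : ℝ) (φ ψ : Eu d → EReal) (x z : Eu d) : ℝ≥0∞ :=
  EReal.exp ((((⟪x, z⟫ : ℝ) : EReal) - φ x - ψ z) / (ε : EReal))

/-- The conditional law `dπ(z | x) = γ(x, z) dν(z)`. -/
noncomputable def forwardCond {d : ℕ} (ε : ℝ) (ν : Measure (Eu d)) (φ ψ : Eu d → EReal)
    (x : Eu d) : Measure (Eu d) :=
  ν.withDensity (fun z => entropicDensity ε φ ψ x z)

/-- The conditional law `dπ(x | z) = γ(x, z) dρ(x)`. -/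
noncomputable def backwardCond {d : ℕ} (ε : ℝ) (ρ : Measure (Eu d)) (φ ψ : Eu d → EReal)
    (z : Eu d) : Measure (Eu d) :=
  ρ.withDensity (fun x => entropicDensity ε φ ψ x z)

/-- The forward entropic Brenier map `T(x) = ∫ z dπ(z | x)`. -/
noncomputable def forwardMap {d : ℕ} (ε : ℝ) (ν : Measure (Eu d)) (φ ψ : Eu d → EReal)
    (x : Eu d) : Eu d :=
  ∫ z, z ∂(forwardCond ε ν φ ψ x)

/-- The backward entropic Brenier map `S(z) = ∫ x dπ(x | z)`. -/
noncomputable def backwardMap {d : ℕ} (ε : ℝ) (ρ : Measure (Eu d)) (φ ψ : Eu d → EReal)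
    (z : Eu d) : Eu d :=
  ∫ x, x ∂(backwardCond ε ρ φ ψ z)

/-- The points at which the forward map is defined: those of `dom φ` at which the integral that
defines the map is well-defined. -/
def forwardDomain {d : ℕ} (ε : ℝ) (ν : Measure (Eu d)) (φ ψ : Eu d → EReal) : Set (Eu d) :=
  {x | φ x < ⊤ ∧ Integrable (fun z : Eu d => z) (forwardCond ε ν φ ψ x)}

/-- The points at which the backward map is defined: those of `dom ψ` at which the integral that
defines the map is well-defined. -/
def backwardDomain {d : ℕ} (ε : ℝ) (ρ : Measure (Eu d)) (φ ψ : Eu d → EReal) : Set (Eu d) :=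
  {z | ψ z < ⊤ ∧ Integrable (fun x : Eu d => x) (backwardCond ε ρ φ ψ z)}

/-! Fix a coupling `κ` of `μ` and `ν`. On the product of `ρ` and `κ`, with points `(x, (y, z))`, the
densities `p = γ^μ(x, y)` and `q = γ^ν(x, z)` both have marginals `ρ` and `κ`. Split `T^μ - T^ν` at
the mean of `z` given `x` under `p`. The first difference is a conditional mean of `y - z`, of `L²`
norm at most the transport cost of `κ`; this is the `1` in the constant.

The second difference compares means of `z` under `p` and `q`. If the conditional laws of `q` are
sub-Gaussian with variance proxy `A` (given `x`) and `B` (given `z`), the Gibbs variational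
principle bounds the squared distance of means by `2A` times the conditional entropy, hence by `2AK`
after integration, with `K = KL(p | q)`. Since `ε log (p / q)` is `⟪x, y - z⟫` plus functions of one
variable, and the marginals agree, `ε (KL(p | q) + KL(q | p))` is the integral of `⟪y - z, S_p -
S_q⟫` for the backward means. The variational principle, now given `z`, bounds this by `εK/2 + (B/ε)
∫ ‖y - z‖²`. Absorbing `εK/2` gives the squared bound `4AB/ε² ∫ ‖y - z‖²`
(`lintegral_sq_condMean_sub_le`).

Tilting a Gibbs kernel by `h` moves its base point by `εh`, so a `Λ`-Lipschitz barycentric map gives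
`A = Λε`; likewise `B = ε/λ`. On a ball, Hoeffding gives `B = R²`. Normalization of the kernels in
both directions comes from optimality of `φ₀` (`IsEntropicPotentials.isSchrodingerSystem`). -/

/-! ### Relative entropy and exponential moments -/

/-- A bound for the exponential moments of the density `q` controls the mean of any other density
`p` by the relative entropy of `p` with respect to `q`. -/
lemma inner_mean_sub_le_of_mgf_le {Y E : Type*} [MeasurableSpace Y] [NormedAddCommGroup E]
    [InnerProductSpace ℝ E] [CompleteSpace E]
    {κ : Measure Y} {p q : Y → ℝ} {v : Y → E} {m h : E} {A : ℝ}
    (hp : ∀ y, 0 < p y) (hq : ∀ y, 0 < q y) (hpm : Measurable p)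
    (hqm : AEStronglyMeasurable (fun y => q y * Real.exp ⟪h, v y⟫) κ)
    (hp1 : ∫⁻ y, ENNReal.ofReal (p y) ∂κ = 1) (hpv : Integrable (fun y => p y • v y) κ)
    (hpq : Integrable (fun y => p y * Real.log (p y / q y)) κ)
    (hmgf : ∫⁻ y, ENNReal.ofReal (q y * Real.exp ⟪h, v y⟫) ∂κ ≤
      ENNReal.ofReal (Real.exp (⟪h, m⟫ + A / 2 * ‖h‖ ^ 2))) :
    ⟪h, (∫ y, p y • v y ∂κ) - m⟫ ≤ (∫ y, p y * Real.log (p y / q y) ∂κ) + A / 2 * ‖h‖ ^ 2 := by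
  set c : ℝ := ⟪h, m⟫ + A / 2 * ‖h‖ ^ 2 with hc
  have hpi : Integrable p κ := by
    refine ⟨hpm.aestronglyMeasurable, ?_⟩
    rw [hasFiniteIntegral_iff_ofReal (Filter.Eventually.of_forall fun y => (hp y).le), hp1]
    exact ENNReal.one_lt_top
  have hpint : ∫ y, p y ∂κ = 1 := by
    rw [integral_eq_lintegral_of_nonneg_ae (Filter.Eventually.of_forall fun y => (hp y).le)
      hpm.aestronglyMeasurable, hp1, ENNReal.toReal_one]
  have hqnn : ∀ y, 0 ≤ q y * Real.exp ⟪h, v y⟫ := fun y => by have := hq y; positivity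
  have hqi : Integrable (fun y => q y * Real.exp ⟪h, v y⟫) κ := by
    refine ⟨hqm, ?_⟩
    rw [hasFiniteIntegral_iff_ofReal (Filter.Eventually.of_forall hqnn)]
    exact hmgf.trans_lt ENNReal.ofReal_lt_top
  have hqint : ∫ y, q y * Real.exp ⟪h, v y⟫ ∂κ ≤ Real.exp c := by
    rw [integral_eq_lintegral_of_nonneg_ae (Filter.Eventually.of_forall hqnn) hqm]
    exact ENNReal.toReal_le_of_le_ofReal (Real.exp_pos _).le hmgf
  have hvi : Integrable (fun y => ⟪h, p y • v y⟫) κ := hpv.const_inner h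
  -- This is `t + 1 ≤ exp t` at `t = ⟪h, v⟫ - c - log (p / q)`, multiplied by `p`; the right side
  -- has nonpositive integral.
  have key : ∀ y, ⟪h, p y • v y⟫ - c * p y - p y * Real.log (p y / q y) ≤
      Real.exp (-c) * (q y * Real.exp ⟪h, v y⟫) - p y := by
    intro y
    have h1 : Real.log (p y / q y) = Real.log (p y) - Real.log (q y) :=
      Real.log_div (hp y).ne' (hq y).ne'
    have h2 : Real.exp (-c) * (q y * Real.exp ⟪h, v y⟫) =
        p y * Real.exp (⟪h, v y⟫ - c - Real.log (p y / q y)) := by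
      rw [h1, show ⟪h, v y⟫ - c - (Real.log (p y) - Real.log (q y)) =
        (-c) + (Real.log (q y) + ⟪h, v y⟫) - Real.log (p y) by ring, Real.exp_sub, Real.exp_add,
        Real.exp_add, Real.exp_log (hp y), Real.exp_log (hq y)]
      have := (hp y).ne'
      field_simp
    rw [h2, inner_smul_right]
    have h3 := Real.add_one_le_exp (⟪h, v y⟫ - c - Real.log (p y / q y))
    have h4 := mul_le_mul_of_nonneg_left h3 (hp y).le
    linarith
  have hvc : Integrable (fun y => ⟪h, p y • v y⟫ - c * p y) κ := hvi.sub (hpi.const_mul c)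
  have hint := integral_mono (hvc.sub hpq) ((hqi.const_mul (Real.exp (-c))).sub hpi) key
  simp only [Pi.sub_apply] at hint
  rw [integral_sub hvc hpq, integral_sub hvi (hpi.const_mul c),
    integral_sub (hqi.const_mul (Real.exp (-c))) hpi, integral_const_mul, integral_const_mul,
    hpint, integral_inner hpv] at hint
  have h5 : Real.exp (-c) * ∫ y, q y * Real.exp ⟪h, v y⟫ ∂κ ≤ 1 := by
    calc _ ≤ Real.exp (-c) * Real.exp c := by gcongr
      _ = 1 := by rw [← Real.exp_add]; simp
  rw [inner_sub_right]
  linarith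

/-- Only multiples `t • w` are tested. The optimal choice is `t = 1 / A`; for `A = 0` the bound is
linear in `t` and forces `w = 0`. -/
lemma norm_sq_le_of_forall_inner_le {E : Type*} [NormedAddCommGroup E] [InnerProductSpace ℝ E]
    {w : E} {k A : ℝ} (hA : 0 ≤ A) (h : ∀ h : E, ⟪h, w⟫ ≤ k + A / 2 * ‖h‖ ^ 2) :
    ‖w‖ ^ 2 ≤ 2 * A * k := by
  have hk : 0 ≤ k := by simpa using h 0
  have key : ∀ t : ℝ, t * ‖w‖ ^ 2 ≤ k + A / 2 * (t ^ 2 * ‖w‖ ^ 2) := by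
    intro t
    have := h (t • w)
    rwa [real_inner_smul_left, real_inner_self_eq_norm_sq, norm_smul, mul_pow,
      Real.norm_eq_abs, sq_abs] at this
  rcases hA.eq_or_lt with rfl | hA
  · by_contra hw
    push Not at hw
    have hw' : 0 < ‖w‖ ^ 2 := by simpa using hw
    have := key ((k + 1) / ‖w‖ ^ 2)
    rw [div_mul_cancel₀ _ hw'.ne'] at this
    linarith
  · have := key (1 / A)
    have h2 : A * (1 / A * ‖w‖ ^ 2) ≤ A * (k + A / 2 * ((1 / A) ^ 2 * ‖w‖ ^ 2)) := by gcongr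
    have h3 : A * (1 / A * ‖w‖ ^ 2) = ‖w‖ ^ 2 := by field_simp
    have h4 : A * (k + A / 2 * ((1 / A) ^ 2 * ‖w‖ ^ 2)) = A * k + ‖w‖ ^ 2 / 2 := by field_simp
    linarith

/-! ### Couplings given by densities -/

/-- A positive density on a product whose marginals are the given measures. -/
structure IsCouplingDensity {X Y : Type*} [MeasurableSpace X] [MeasurableSpace Y]
    (ρ : Measure X) (κ : Measure Y) (G : X → Y → ℝ) : Prop where
  measurable : Measurable (Function.uncurry G)
  pos : ∀ x y, 0 < G x y
  left : ∀ᵐ x ∂ρ, ∫⁻ y, ENNReal.ofReal (G x y) ∂κ = 1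
  right : ∀ᵐ y ∂κ, ∫⁻ x, ENNReal.ofReal (G x y) ∂ρ = 1

namespace IsCouplingDensity

variable {X Y : Type*} [MeasurableSpace X] [MeasurableSpace Y] {ρ : Measure X} {κ : Measure Y}
  {G : X → Y → ℝ}

lemma swap (h : IsCouplingDensity ρ κ G) : IsCouplingDensity κ ρ (fun y x => G x y) :=
  ⟨h.measurable.comp measurable_swap, fun y x => h.pos x y, h.right, h.left⟩

lemma measurable_left (h : IsCouplingDensity ρ κ G) (x : X) : Measurable (G x) :=
  h.measurable.comp measurable_prodMk_left

lemma measurable_right (h : IsCouplingDensity ρ κ G) (y : Y) : Measurable (fun x => G x y) :=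
  h.measurable.comp measurable_prodMk_right

lemma integral_left (h : IsCouplingDensity ρ κ G) : ∀ᵐ x ∂ρ, ∫ y, G x y ∂κ = 1 := by
  filter_upwards [h.left] with x hx
  rw [integral_eq_lintegral_of_nonneg_ae (Filter.Eventually.of_forall fun y => (h.pos x y).le)
      (h.measurable_left x).aestronglyMeasurable, hx, ENNReal.toReal_one]

variable [SFinite κ]

lemma integrable_smul_fst {E : Type*} [NormedAddCommGroup E] [NormedSpace ℝ E]
    (h : IsCouplingDensity ρ κ G) {u : X → E} (hu : Integrable u ρ) :
    Integrable (fun p : X × Y => G p.1 p.2 • u p.1) (ρ.prod κ) := by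
  have hm : AEStronglyMeasurable (fun p : X × Y => G p.1 p.2 • u p.1) (ρ.prod κ) :=
    h.measurable.aestronglyMeasurable.smul hu.aestronglyMeasurable.comp_fst
  refine ⟨hm, ?_⟩
  rw [hasFiniteIntegral_iff_enorm, lintegral_prod _ hm.enorm]
  have : ∫⁻ x, ∫⁻ y, ‖G x y • u x‖ₑ ∂κ ∂ρ = ∫⁻ x, ‖u x‖ₑ ∂ρ := by
    refine lintegral_congr_ae ?_
    filter_upwards [h.left] with x hx
    simp_rw [enorm_smul, Real.enorm_of_nonneg (h.pos x _).le]
    rw [lintegral_mul_const _ (h.measurable_left x).ennreal_ofReal, hx, one_mul]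
  rw [this]
  exact hu.2

variable [SFinite ρ]

lemma integral_smul_fst {E : Type*} [NormedAddCommGroup E] [NormedSpace ℝ E] [CompleteSpace E]
    (h : IsCouplingDensity ρ κ G) {u : X → E} (hu : Integrable u ρ) :
    ∫ p : X × Y, G p.1 p.2 • u p.1 ∂(ρ.prod κ) = ∫ x, u x ∂ρ := by
  rw [integral_prod _ (h.integrable_smul_fst hu)]
  refine integral_congr_ae ?_
  filter_upwards [h.integral_left] with x hx
  simp only [integral_smul_const, hx, one_smul]

lemma integrable_smul_snd {E : Type*} [NormedAddCommGroup E] [NormedSpace ℝ E]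
    (h : IsCouplingDensity ρ κ G) {u : Y → E} (hu : Integrable u κ) :
    Integrable (fun p : X × Y => G p.1 p.2 • u p.2) (ρ.prod κ) :=
  (h.swap.integrable_smul_fst hu).swap

lemma integral_smul_snd {E : Type*} [NormedAddCommGroup E] [NormedSpace ℝ E] [CompleteSpace E]
    (h : IsCouplingDensity ρ κ G) {u : Y → E} (hu : Integrable u κ) :
    ∫ p : X × Y, G p.1 p.2 • u p.2 ∂(ρ.prod κ) = ∫ y, u y ∂κ := by
  rw [← h.swap.integral_smul_fst hu]
  exact (integral_prod_swap (fun p : X × Y => G p.1 p.2 • u p.2)).symm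

end IsCouplingDensity

/-! ### Stability of conditional means -/

/-- If `p` and `q` are densities of two couplings of `ρ` and `κ` whose log-ratio is, up to functions
of one variable, `⟪x, y - z⟫ / ε`, and if the conditional laws of `q` in both directions satisfy
exponential moment bounds, then the conditional means of `z` given `x` under the two
couplings are close. -/
theorem lintegral_sq_condMean_sub_le {E : Type*} [NormedAddCommGroup E] [InnerProductSpace ℝ E]
    [CompleteSpace E] [MeasurableSpace E] [BorelSpace E] [SecondCountableTopology E]
    {ρ : Measure E} {κ : Measure (E × E)} [IsFiniteMeasure ρ] [IsFiniteMeasure κ]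
    {p q : E → E × E → ℝ} (hp : IsCouplingDensity ρ κ p) (hq : IsCouplingDensity ρ κ q)
    {ε : ℝ} (hε : 0 < ε) {u : E → ℝ} {w : E × E → ℝ} (hu : Integrable u ρ) (hw : Integrable w κ)
    (hlog : ∀ x b, ε * Real.log (p x b / q x b) = ⟪x, b.1 - b.2⟫ + u x + w b)
    (hρ : MemLp (fun x : E => x) 2 ρ) (hκ1 : MemLp (fun b : E × E => b.1) 2 κ)
    (hκ2 : MemLp (fun b : E × E => b.2) 2 κ)
    {T : E → E} {S : E × E → E} {A B : ℝ} (hA : 0 ≤ A)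
    (hT : ∀ᵐ x ∂ρ, ∀ h : E, ∫⁻ b, ENNReal.ofReal (q x b * Real.exp ⟪h, b.2⟫) ∂κ ≤
      ENNReal.ofReal (Real.exp (⟪h, T x⟫ + A / 2 * ‖h‖ ^ 2)))
    (hSq : ∀ᵐ b ∂κ, ∫ x, q x b • x ∂ρ = S b)
    (hS : ∀ᵐ b ∂κ, ∀ h : E, ∫⁻ x, ENNReal.ofReal (q x b * Real.exp ⟪h, x⟫) ∂ρ ≤
      ENNReal.ofReal (Real.exp (⟪h, S b⟫ + B / 2 * ‖h‖ ^ 2))) :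
    ∫⁻ x, ‖(∫ b, p x b • b.2 ∂κ) - T x‖ₑ ^ 2 ∂ρ ≤
      ENNReal.ofReal (4 * A * B / ε ^ 2 * ∫ b, ‖b.1 - b.2‖ ^ 2 ∂κ) := by
  set D : ℝ := ∫ b, ‖b.1 - b.2‖ ^ 2 ∂κ with hD
  have hκ : MemLp (fun b : E × E => b.1 - b.2) 2 κ := hκ1.sub hκ2
  have hρ2 : Integrable (fun x : E => ‖x‖ ^ 2) ρ := hρ.integrable_norm_pow two_ne_zero
  have hκsq : Integrable (fun b : E × E => ‖b.1 - b.2‖ ^ 2) κ := hκ.integrable_norm_pow two_ne_zero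
  have hρ1 : Integrable (fun x : E => x) ρ := hρ.integrable one_le_two
  have hκi : Integrable (fun b : E × E => b.2) κ := hκ2.integrable one_le_two
  -- integrability of the inner product and of the log-ratio
  have hin : ∀ G : E → E × E → ℝ, IsCouplingDensity ρ κ G →
      Integrable (fun a : E × E × E => G a.1 a.2 * ⟪a.1, a.2.1 - a.2.2⟫) (ρ.prod κ) := by
    intro G hG
    have h1 := (hG.integrable_smul_fst hρ2).add (hG.integrable_smul_snd hκsq)
    refine h1.mono' (hG.measurable.mul (by fun_prop)).aestronglyMeasurable ?_
    refine Filter.Eventually.of_forall fun a => ?_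
    have h2 := hG.pos a.1 a.2
    have h3 := abs_real_inner_le_norm a.1 (a.2.1 - a.2.2)
    simp only [norm_mul, Real.norm_eq_abs, abs_of_pos h2, Pi.add_apply, smul_eq_mul]
    rw [← mul_add]
    gcongr
    nlinarith [sq_nonneg (‖a.1‖ - ‖a.2.1 - a.2.2‖), norm_nonneg a.1,
      norm_nonneg (a.2.1 - a.2.2), sq_nonneg ‖a.1‖, sq_nonneg ‖a.2.1 - a.2.2‖]
  set l : E → E × E → ℝ := fun x b => Real.log (p x b / q x b) with hl
  have hlε : ∀ x b, l x b = ε⁻¹ * (⟪x, b.1 - b.2⟫ + u x + w b) := fun x b => by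
    rw [← hlog, ← mul_assoc, inv_mul_cancel₀ hε.ne', one_mul]
  have hdec : ∀ G : E → E × E → ℝ, (fun a : E × E × E => G a.1 a.2 * l a.1 a.2) =
      fun a => ε⁻¹ * (G a.1 a.2 * ⟪a.1, a.2.1 - a.2.2⟫ + G a.1 a.2 • u a.1 + G a.1 a.2 • w a.2) := by
    intro G
    funext a
    rw [hlε]
    simp only [smul_eq_mul]
    ring
  have hGl : ∀ G : E → E × E → ℝ, IsCouplingDensity ρ κ G →
      Integrable (fun a : E × E × E => G a.1 a.2 * l a.1 a.2) (ρ.prod κ) := by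
    intro G hG
    rw [hdec]
    exact (((hin G hG).add (hG.integrable_smul_fst hu)).add (hG.integrable_smul_snd hw)).const_mul _
  -- The terms in `u` and `w` depend only on the marginals, so they agree for `p` and `q` and cancel
  -- in the comparison below.
  have hGint : ∀ G : E → E × E → ℝ, IsCouplingDensity ρ κ G →
      ∫ a : E × E × E, G a.1 a.2 * l a.1 a.2 ∂(ρ.prod κ) =
      ε⁻¹ * (∫ a : E × E × E, G a.1 a.2 * ⟪a.1, a.2.1 - a.2.2⟫ ∂(ρ.prod κ)
        + ∫ x, u x ∂ρ + ∫ b, w b ∂κ) := by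
    intro G hG
    have hs : Integrable (fun a : E × E × E =>
        G a.1 a.2 * ⟪a.1, a.2.1 - a.2.2⟫ + G a.1 a.2 • u a.1) (ρ.prod κ) :=
      (hin G hG).add (hG.integrable_smul_fst hu)
    rw [hdec, integral_const_mul, integral_add hs (hG.integrable_smul_snd hw),
      integral_add (hin G hG) (hG.integrable_smul_fst hu), hG.integral_smul_fst hu,
      hG.integral_smul_snd hw]
  set k : E → ℝ := fun x => ∫ b, p x b * l x b ∂κ with hk
  set k' : E × E → ℝ := fun b => ∫ x, p x b * l x b ∂ρ with hk'
  set K : ℝ := ∫ a : E × E × E, p a.1 a.2 * l a.1 a.2 ∂(ρ.prod κ) with hK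
  have hKk : K = ∫ x, k x ∂ρ := integral_prod _ (hGl p hp)
  have hKk' : K = ∫ b, k' b ∂κ := integral_prod_symm _ (hGl p hp)
  have hki : Integrable k ρ := (hGl p hp).integral_prod_left
  have hki' : Integrable k' κ := (hGl p hp).integral_prod_right
  -- nonnegativity of the reverse entropy
  have hrev : ∫ a : E × E × E, q a.1 a.2 * l a.1 a.2 ∂(ρ.prod κ) ≤ 0 := by
    have hone : Integrable (fun _ : E => (1 : ℝ)) ρ := integrable_const _
    have h1 := (hp.integrable_smul_fst hone).sub (hq.integrable_smul_fst hone)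
    -- Pointwise `q log (p / q) ≤ p - q`, and `p`, `q` have the same total mass.
    have h2 := integral_mono (hGl q hq) h1 (fun a => by
      have hpa := hp.pos a.1 a.2
      have hqa := hq.pos a.1 a.2
      have := Real.log_le_sub_one_of_pos (div_pos hpa hqa)
      have h3 := mul_le_mul_of_nonneg_left this hqa.le
      have h4 : q a.1 a.2 * (p a.1 a.2 / q a.1 a.2 - 1) = p a.1 a.2 - q a.1 a.2 := by
        field_simp
      simpa [h4] using h3)
    refine h2.trans_eq ?_
    simp only [Pi.sub_apply]
    rw [integral_sub (hp.integrable_smul_fst hone) (hq.integrable_smul_fst hone),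
      hp.integral_smul_fst hone, hq.integral_smul_fst hone, sub_self]
  set Sp : E × E → E := fun b => ∫ x, p x b • x ∂ρ with hSp
  have hinner : ∀ G : E → E × E → ℝ, IsCouplingDensity ρ κ G →
      ∫ a : E × E × E, G a.1 a.2 * ⟪a.1, a.2.1 - a.2.2⟫ ∂(ρ.prod κ) =
        ∫ b, ⟪b.1 - b.2, ∫ x, G x b • x ∂ρ⟫ ∂κ ∧
      Integrable (fun b : E × E => ⟪b.1 - b.2, ∫ x, G x b • x ∂ρ⟫) κ := by
    intro G hG
    have h1 : ∀ᵐ b ∂κ, ∫ x, G x b * ⟪x, b.1 - b.2⟫ ∂ρ = ⟪b.1 - b.2, ∫ x, G x b • x ∂ρ⟫ := by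
      filter_upwards [(hG.integrable_smul_fst hρ1).prod_left_ae] with b hb
      rw [← integral_inner hb]
      simp_rw [inner_smul_right, real_inner_comm]
    constructor
    · rw [integral_prod_symm _ (hin G hG)]
      exact integral_congr_ae h1
    · exact (hin G hG).integral_prod_right.congr h1
  -- the entropy bound
  have hεK : ε * K ≤ ∫ b, ⟪b.1 - b.2, Sp b - S b⟫ ∂κ := by
    have h1 := hGint p hp
    have h2 := hGint q hq
    rw [(hinner p hp).1, ← hK] at h1
    rw [h2, (hinner q hq).1] at hrev
    have h3 : ∫ b, ⟪b.1 - b.2, Sp b - S b⟫ ∂κ = ∫ b, ⟪b.1 - b.2, ∫ x, p x b • x ∂ρ⟫ ∂κ -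
        ∫ b, ⟪b.1 - b.2, ∫ x, q x b • x ∂ρ⟫ ∂κ := by
      rw [← integral_sub (hinner p hp).2 (hinner q hq).2]
      refine integral_congr_ae ?_
      filter_upwards [hSq] with b hb
      rw [inner_sub_right, ← hb]
    have h4 : ε * K = ∫ b, ⟪b.1 - b.2, ∫ x, p x b • x ∂ρ⟫ ∂κ + ∫ x, u x ∂ρ + ∫ b, w b ∂κ := by
      rw [h1, ← mul_assoc, mul_inv_cancel₀ hε.ne', one_mul]
    have h5 : ∫ b, ⟪b.1 - b.2, ∫ x, q x b • x ∂ρ⟫ ∂κ + ∫ x, u x ∂ρ + ∫ b, w b ∂κ ≤ 0 :=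
      nonpos_of_mul_nonpos_right hrev (inv_pos.2 hε)
    rw [h3, h4]
    linarith
  have hpt : ∀ᵐ b ∂κ, ⟪b.1 - b.2, Sp b - S b⟫ ≤ ε / 2 * k' b + B / ε * ‖b.1 - b.2‖ ^ 2 := by
    filter_upwards [hS, hp.right, (hp.integrable_smul_fst hρ1).prod_left_ae,
      (hGl p hp).prod_left_ae] with b hb1 hb2 hb3 hb4
    -- The factor `2 / ε` makes the entropy term `ε / 2 * k'`, half of the left side of `hεK` after
    -- integration, so that it can be absorbed.
    have h1 := inner_mean_sub_le_of_mgf_le (h := (2 / ε) • (b.1 - b.2)) (fun x => hp.pos x b)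
      (fun x => hq.pos x b) (hp.measurable_right b)
      ((hq.measurable_right b).mul (by fun_prop)).aestronglyMeasurable hb2 hb3 hb4 (hb1 _)
    rw [real_inner_smul_left, norm_smul, mul_pow, Real.norm_eq_abs, sq_abs] at h1
    have h2 := mul_le_mul_of_nonneg_left h1 (half_pos hε).le
    have h3 : ε / 2 * (2 / ε * ⟪b.1 - b.2, Sp b - S b⟫) = ⟪b.1 - b.2, Sp b - S b⟫ := by field_simp
    have h4 : ε / 2 * (k' b + B / 2 * ((2 / ε) ^ 2 * ‖b.1 - b.2‖ ^ 2)) =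
        ε / 2 * k' b + B / ε * ‖b.1 - b.2‖ ^ 2 := by field_simp
    rw [← h3, ← h4]
    exact h2
  have hintS : Integrable (fun b : E × E => ⟪b.1 - b.2, Sp b - S b⟫) κ := by
    refine ((hinner p hp).2.sub (hinner q hq).2).congr ?_
    filter_upwards [hSq] with b hb
    simp only [Pi.sub_apply]
    rw [inner_sub_right, ← hb]
  have hKle : K ≤ 2 * B / ε ^ 2 * D := by
    have h1 := integral_mono_ae hintS ((hki'.const_mul (ε / 2)).add (hκsq.const_mul (B / ε))) hpt
    simp only [Pi.add_apply] at h1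
    rw [integral_add (hki'.const_mul (ε / 2)) (hκsq.const_mul (B / ε)), integral_const_mul,
      integral_const_mul, ← hKk', ← hD] at h1
    have h2 : ε / 2 * K ≤ B / ε * D := by linarith
    have h3 := mul_le_mul_of_nonneg_left h2 (div_pos two_pos hε).le
    have h4 : 2 / ε * (ε / 2 * K) = K := by field_simp
    have h5 : 2 / ε * (B / ε * D) = 2 * B / ε ^ 2 * D := by field_simp
    rwa [h4, h5] at h3
  -- the forward estimate
  have hforw : ∀ᵐ x ∂ρ, ‖(∫ b, p x b • b.2 ∂κ) - T x‖ ^ 2 ≤ 2 * A * k x := by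
    filter_upwards [hT, hp.left, (hp.integrable_smul_snd hκi).prod_right_ae,
      (hGl p hp).prod_right_ae] with x hx1 hx2 hx3 hx4
    exact norm_sq_le_of_forall_inner_le hA fun h => inner_mean_sub_le_of_mgf_le
      (fun b => hp.pos x b) (fun b => hq.pos x b) (hp.measurable_left x)
      ((hq.measurable_left x).mul (by fun_prop)).aestronglyMeasurable hx2 hx3 hx4 (hx1 h)
  calc ∫⁻ x, ‖(∫ b, p x b • b.2 ∂κ) - T x‖ₑ ^ 2 ∂ρ
      ≤ ∫⁻ x, ENNReal.ofReal (2 * A * k x) ∂ρ := by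
        refine lintegral_mono_ae ?_
        filter_upwards [hforw] with x hx
        rw [← ofReal_norm, ← ENNReal.ofReal_pow (norm_nonneg _)]
        exact ENNReal.ofReal_le_ofReal hx
    _ = ENNReal.ofReal (∫ x, 2 * A * k x ∂ρ) := by
        refine (ofReal_integral_eq_lintegral_ofReal (hki.const_mul _) ?_).symm
        filter_upwards [hforw] with x hx
        exact (sq_nonneg _).trans hx
    _ ≤ _ := by
        refine ENNReal.ofReal_le_ofReal ?_
        rw [integral_const_mul, ← hKk]
        calc 2 * A * K ≤ 2 * A * (2 * B / ε ^ 2 * D) := by gcongr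
          _ = _ := by ring

/-! ### Sub-Gaussian bounds for Gibbs kernels and for laws on a ball -/

/-- A Lipschitz subgradient gives the quadratic upper bound of semiconcavity. -/
lemma le_add_quadratic_of_lipschitz_subgradient {E : Type*} [NormedAddCommGroup E]
    [InnerProductSpace ℝ E] {f : E → ℝ} {T : E → E} {Λ : ℝ≥0}
    (hsub : ∀ x x', f x + ⟪T x, x' - x⟫ ≤ f x') (hT : LipschitzWith Λ T) (x h : E) :
    f (x + h) ≤ f x + ⟪T x, h⟫ + Λ / 2 * ‖h‖ ^ 2 := by
  -- A discrete substitute for integrating the gradient along the segment: each step uses the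
  -- subgradient at its far endpoint, tested backwards. The errors `Λ j ‖v‖²`, `1 ≤ j ≤ k`, sum to
  -- the last term; with `v = h / n` and `k = n`, the excess over the claim vanishes as `n → ∞`.
  have step : ∀ (v : E) (k : ℕ),
      f (x + (k : ℝ) • v) ≤ f x + k * ⟪T x, v⟫ + Λ * ‖v‖ ^ 2 * (k * (k + 1) / 2) := by
    intro v k
    induction k with
    | zero => simp
    | succ k ih =>
      have h1 := hsub (x + ((k + 1 : ℕ) : ℝ) • v) (x + (k : ℝ) • v)
      have h2 : x + (k : ℝ) • v - (x + ((k + 1 : ℕ) : ℝ) • v) = -v := by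
        push_cast; rw [add_smul, one_smul]; abel
      rw [h2, inner_neg_right] at h1
      have h3 : ⟪T (x + ((k + 1 : ℕ) : ℝ) • v) - T x, v⟫ ≤ Λ * (k + 1) * ‖v‖ ^ 2 := by
        refine (real_inner_le_norm _ _).trans ?_
        have h4 := hT.norm_sub_le (x + ((k + 1 : ℕ) : ℝ) • v) x
        rw [add_sub_cancel_left, norm_smul, Real.norm_of_nonneg (Nat.cast_nonneg _)] at h4
        calc _ ≤ (Λ * (((k + 1 : ℕ) : ℝ) * ‖v‖)) * ‖v‖ := by gcongr
          _ = _ := by push_cast; ring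
      rw [inner_sub_left] at h3
      push_cast at *
      nlinarith
  have bound : ∀ n : ℕ, 0 < n →
      f (x + h) ≤ f x + ⟪T x, h⟫ + Λ / 2 * ‖h‖ ^ 2 + (Λ / 2 * ‖h‖ ^ 2) / n := by
    intro n hn
    have hn' : (0 : ℝ) < n := Nat.cast_pos.2 hn
    have h1 := step ((n : ℝ)⁻¹ • h) n
    rw [smul_smul, mul_inv_cancel₀ hn'.ne', one_smul, inner_smul_right, norm_smul, mul_pow,
      Real.norm_of_nonneg (inv_nonneg.2 hn'.le), ← mul_assoc, mul_inv_cancel₀ hn'.ne',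
      one_mul] at h1
    refine h1.trans_eq ?_
    field_simp
    ring
  have hlim := (tendsto_const_div_atTop_nhds_zero_nat (Λ / 2 * ‖h‖ ^ 2 : ℝ)).const_add
    (f x + ⟪T x, h⟫ + Λ / 2 * ‖h‖ ^ 2)
  rw [add_zero] at hlim
  exact ge_of_tendsto hlim (Filter.eventually_atTop.2 ⟨1, fun n hn => bound n hn⟩)

/-- The Gibbs density `exp((⟪x, z⟫ - f x - g z) / ε)` for real-valued potentials. -/
noncomputable def gibbs {E : Type*} [NormedAddCommGroup E] [InnerProductSpace ℝ E]
    (ε : ℝ) (f g : E → ℝ) (x z : E) : ℝ :=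
  Real.exp ((⟪x, z⟫ - f x - g z) / ε)

section Gibbs

variable {E : Type*} [NormedAddCommGroup E] [InnerProductSpace ℝ E]

lemma gibbs_pos (ε : ℝ) (f g : E → ℝ) (x z : E) : 0 < gibbs ε f g x z := Real.exp_pos _

lemma gibbs_swap (ε : ℝ) (f g : E → ℝ) (x z : E) : gibbs ε f g x z = gibbs ε g f z x := by
  unfold gibbs
  rw [real_inner_comm]
  ring_nf

variable [MeasurableSpace E] [BorelSpace E] [SecondCountableTopology E]

lemma measurable_gibbs {ε : ℝ} {f g : E → ℝ} (hf : Measurable f) (hg : Measurable g) :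
    Measurable (fun p : E × E => gibbs ε f g p.1 p.2) := by
  unfold gibbs
  have : Measurable (fun p : E × E => ⟪p.1, p.2⟫) := continuous_inner.measurable
  fun_prop

lemma measurable_gibbs_right {ε : ℝ} {f g : E → ℝ} (hg : Measurable g) (x : E) :
    Measurable (gibbs ε f g x) := by
  unfold gibbs
  fun_prop

/-- If the barycentric map of a Gibbs kernel is Lipschitz, then the kernel is sub-Gaussian. -/
lemma lintegral_gibbs_mul_exp_le_of_lipschitz [CompleteSpace E] {σ : Measure E} {ε : ℝ} (hε : 0 < ε)
    {f g : E → ℝ} (hg : Measurable g)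
    (hone : ∀ x, ∫⁻ z, ENNReal.ofReal (gibbs ε f g x z) ∂σ = 1)
    (hint : ∀ x, Integrable (fun z => gibbs ε f g x z • z) σ) {Λ : ℝ≥0}
    (hlip : LipschitzWith Λ (fun x => ∫ z, gibbs ε f g x z • z ∂σ)) (x h : E) :
    ∫⁻ z, ENNReal.ofReal (gibbs ε f g x z * Real.exp ⟪h, z⟫) ∂σ ≤
      ENNReal.ofReal (Real.exp
        (⟪h, ∫ z, gibbs ε f g x z • z ∂σ⟫ + (Λ * ε) / 2 * ‖h‖ ^ 2)) := by
  set T : E → E := fun x => ∫ z, gibbs ε f g x z • z ∂σ with hT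
  have hnn : ∀ x, 0 ≤ᵐ[σ] gibbs ε f g x :=
    fun x => Filter.Eventually.of_forall fun z => (gibbs_pos ε f g x z).le
  have hmeas : ∀ x, AEStronglyMeasurable (gibbs ε f g x) σ :=
    fun x => (measurable_gibbs_right hg x).aestronglyMeasurable
  have hi : ∀ x, Integrable (gibbs ε f g x) σ := fun x => by
    refine ⟨hmeas x, ?_⟩
    rw [hasFiniteIntegral_iff_ofReal (hnn x), hone]
    exact ENNReal.one_lt_top
  have hi1 : ∀ x, ∫ z, gibbs ε f g x z ∂σ = 1 := fun x => by
    rw [integral_eq_lintegral_of_nonneg_ae (hnn x) (hmeas x), hone, ENNReal.toReal_one]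
  -- Normalization makes `f` a log-partition function, and its barycentric map is a subgradient:
  -- integrate `1 + t ≤ exp t` against the kernel at `x`, where `exp t` is the ratio of the kernels
  -- at `x'` and `x`.
  have hsub : ∀ x x', f x + ⟪T x, x' - x⟫ ≤ f x' := by
    intro x x'
    have hin : Integrable (fun z => ⟪x' - x, gibbs ε f g x z • z⟫) σ := (hint x).const_inner _
    have h1 : ∀ z, gibbs ε f g x z * (1 - (f x' - f x) / ε) +
        ε⁻¹ * ⟪x' - x, gibbs ε f g x z • z⟫ ≤ gibbs ε f g x' z := by
      intro z
      have h2 : gibbs ε f g x' z =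
          gibbs ε f g x z * Real.exp ((⟪x' - x, z⟫ - (f x' - f x)) / ε) := by
        unfold gibbs
        rw [← Real.exp_add, inner_sub_left]
        ring_nf
      have h3 := Real.add_one_le_exp ((⟪x' - x, z⟫ - (f x' - f x)) / ε)
      have h4 := mul_le_mul_of_nonneg_left h3 (gibbs_pos ε f g x z).le
      rw [h2, inner_smul_right]
      refine le_trans (le_of_eq ?_) h4
      field_simp
      ring
    have h5 := integral_mono (((hi x).mul_const _).add (hin.const_mul _)) (hi x') h1
    simp only [Pi.add_apply] at h5
    rw [integral_add ((hi x).mul_const _) (hin.const_mul _), integral_mul_const,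
      integral_const_mul, integral_inner (hint x), hi1, hi1, real_inner_comm] at h5
    have h6 : ε⁻¹ * ⟪T x, x' - x⟫ ≤ (f x' - f x) / ε := by linarith
    rw [inv_mul_eq_div, div_le_div_iff_of_pos_right hε] at h6
    linarith
  have hquad := le_add_quadratic_of_lipschitz_subgradient hsub hlip x (ε • h)
  -- Exponential tilting by `h` is, up to normalization, the shift of the base point to `x + ε • h`.
  -- The moment is thus `exp ((f (x + ε • h) - f x) / ε)`.
  have h1 : ∀ z, gibbs ε f g x z * Real.exp ⟪h, z⟫ =
      Real.exp ((f (x + ε • h) - f x) / ε) * gibbs ε f g (x + ε • h) z := by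
    intro z
    unfold gibbs
    rw [← Real.exp_add, ← Real.exp_add, inner_add_left, real_inner_smul_left]
    congr 1
    field_simp
    ring
  simp_rw [h1, ENNReal.ofReal_mul (Real.exp_pos _).le]
  rw [lintegral_const_mul' _ _ ENNReal.ofReal_ne_top, hone, mul_one]
  refine ENNReal.ofReal_le_ofReal (Real.exp_le_exp.2 ?_)
  rw [div_le_iff₀ hε]
  rw [inner_smul_right, norm_smul, mul_pow, Real.norm_of_nonneg hε.le, real_inner_comm] at hquad
  change _ ≤ (⟪h, T x⟫ + _) * ε
  nlinarith

/-- Hoeffding's bound for the exponential moments of a density on a ball. -/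
lemma lintegral_mul_exp_le_of_ball [CompleteSpace E] {ρ : Measure E} {q : E → ℝ}
    (hq : ∀ x, 0 < q x) (hqm : Measurable q) (hone : ∫⁻ x, ENNReal.ofReal (q x) ∂ρ = 1) {R : ℝ}
    (hR : ρ (Metric.closedBall 0 R)ᶜ = 0) (hint : Integrable (fun x => q x • x) ρ) (h : E) :
    ∫⁻ x, ENNReal.ofReal (q x * Real.exp ⟪h, x⟫) ∂ρ ≤
      ENNReal.ofReal (Real.exp (⟪h, ∫ x, q x • x ∂ρ⟫ + R ^ 2 / 2 * ‖h‖ ^ 2)) := by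
  set σ : Measure E := ρ.withDensity (fun x => ENNReal.ofReal (q x)) with hσ
  have : IsProbabilityMeasure σ := ⟨by rw [hσ, withDensity_apply _ .univ, setLIntegral_univ, hone]⟩
  have hball : ∀ᵐ x ∂σ, x ∈ Metric.closedBall (0 : E) R :=
    (withDensity_absolutelyContinuous _ _).ae_le (mem_ae_iff.2 hR)
  have hb : ∀ᵐ x ∂σ, ⟪h, x⟫ ∈ Set.Icc (-(R * ‖h‖)) (R * ‖h‖) := by
    filter_upwards [hball] with x hx
    rw [mem_closedBall_zero_iff] at hx
    refine abs_le.1 ((abs_real_inner_le_norm h x).trans ?_)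
    rw [mul_comm]
    gcongr
  have hsg := ProbabilityTheory.hasSubgaussianMGF_of_mem_Icc
    (X := fun x : E => ⟪h, x⟫) (by fun_prop) hb
  have hmean : ∫ x, ⟪h, x⟫ ∂σ = ⟪h, ∫ x, q x • x ∂ρ⟫ := by
    rw [hσ, integral_withDensity_eq_integral_toReal_smul hqm.ennreal_ofReal
      (Filter.Eventually.of_forall fun _ => ENNReal.ofReal_lt_top), ← integral_inner hint]
    refine integral_congr_ae (Filter.Eventually.of_forall fun x => ?_)
    simp only [ENNReal.toReal_ofReal (hq x).le, inner_smul_right, smul_eq_mul]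
  have hm := hsg.mgf_le 1
  have hei := hsg.integrable_exp_mul 1
  rw [hmean] at hm hei
  set m := ⟪h, ∫ x, q x • x ∂ρ⟫ with hmdef
  simp only [ProbabilityTheory.mgf, one_mul] at hm hei
  have h1 : ∫⁻ x, ENNReal.ofReal (q x * Real.exp ⟪h, x⟫) ∂ρ =
      ENNReal.ofReal (Real.exp m) * ∫⁻ x, ENNReal.ofReal (Real.exp (⟪h, x⟫ - m)) ∂σ := by
    rw [← lintegral_const_mul' _ _ ENNReal.ofReal_ne_top, hσ,
      lintegral_withDensity_eq_lintegral_mul _ hqm.ennreal_ofReal (by fun_prop)]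
    refine lintegral_congr fun x => ?_
    rw [Pi.mul_apply, ← ENNReal.ofReal_mul (Real.exp_pos _).le, ← Real.exp_add,
      add_sub_cancel, ENNReal.ofReal_mul (hq x).le]
  rw [h1, ← ofReal_integral_eq_lintegral_ofReal hei
    (Filter.Eventually.of_forall fun _ => (Real.exp_pos _).le), Real.exp_add,
    ENNReal.ofReal_mul (Real.exp_pos _).le]
  gcongr
  refine hm.trans_eq ?_
  congr 1
  -- Hoeffding's variance proxy is the squared half-length of the interval.
  have : ((‖R * ‖h‖ - -(R * ‖h‖)‖₊ : ℝ) / 2) ^ 2 = R ^ 2 * ‖h‖ ^ 2 := by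
    rw [sub_neg_eq_add, ← two_mul, coe_nnnorm, norm_mul, Real.norm_eq_abs, Real.norm_eq_abs,
      abs_two, mul_div_cancel_left₀ _ two_ne_zero, sq_abs, mul_pow]
  push_cast at this ⊢
  rw [this]
  ring

end Gibbs

/-! ### Integrals of extended-real functions -/

lemma erealIntegral_coe {d : ℕ} {ν : Measure (Eu d)} {F : Eu d → EReal} {g : Eu d → ℝ}
    (hg : Integrable g ν) (hF : ∀ᵐ z ∂ν, F z = g z) :
    erealIntegral ν F = ((∫ z, g z ∂ν : ℝ) : EReal) := by
  have h1 : ∫⁻ z, (F z).toENNReal ∂ν = ∫⁻ z, ENNReal.ofReal (g z) ∂ν :=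
    lintegral_congr_ae (hF.mono fun z hz => by simp only [hz, EReal.real_coe_toENNReal])
  have h2 : ∫⁻ z, (-F z).toENNReal ∂ν = ∫⁻ z, ENNReal.ofReal (-g z) ∂ν :=
    lintegral_congr_ae (hF.mono fun z hz => by
      simp only [hz, ← EReal.coe_neg, EReal.real_coe_toENNReal])
  have h3 : ∫⁻ z, ENNReal.ofReal (g z) ∂ν ≠ ⊤ := hg.lintegral_lt_top.ne
  have h4 : ∫⁻ z, ENNReal.ofReal (-g z) ∂ν ≠ ⊤ := hg.neg.lintegral_lt_top.ne
  rw [erealIntegral, h1, h2, integral_eq_lintegral_pos_part_sub_lintegral_neg_part hg,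
    EReal.coe_sub, EReal.coe_ennreal_toReal h3, EReal.coe_ennreal_toReal h4]

lemma erealIntegral_mono {d : ℕ} {ν : Measure (Eu d)} {F G : Eu d → EReal} (h : ∀ z, F z ≤ G z) :
    erealIntegral ν F ≤ erealIntegral ν G := by
  refine EReal.sub_le_sub ?_ ?_
  · exact EReal.coe_ennreal_le_coe_ennreal_iff.2
      (lintegral_mono fun z => EReal.toENNReal_le_toENNReal (h z))
  · exact EReal.coe_ennreal_le_coe_ennreal_iff.2
      (lintegral_mono fun z => EReal.toENNReal_le_toENNReal (EReal.neg_le_neg_iff.2 (h z)))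

/-- An extended-real function with an integrable lower bound and an integral that is not `⊤` is
almost everywhere finite, with integrable real part. -/
lemma integrable_toReal_of_erealIntegral_ne_top {d : ℕ} {ν : Measure (Eu d)} {F : Eu d → EReal}
    (hF : Measurable F) {l : Eu d → ℝ} (hl : Integrable l ν) (hlF : ∀ z, (l z : EReal) ≤ F z)
    (h : erealIntegral ν F ≠ ⊤) :
    (∀ᵐ z ∂ν, F z = (F z).toReal) ∧ Integrable (fun z => (F z).toReal) ν := by
  have hneg : ∫⁻ z, (-F z).toENNReal ∂ν ≠ ⊤ := by
    refine ne_top_of_le_ne_top hl.neg.lintegral_lt_top.ne (lintegral_mono fun z => ?_)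
    refine (EReal.toENNReal_le_toENNReal (EReal.neg_le_neg_iff.2 (hlF z))).trans_eq ?_
    rw [← EReal.coe_neg, EReal.real_coe_toENNReal]
    rfl
  have hpos : ∫⁻ z, (F z).toENNReal ∂ν ≠ ⊤ := by
    intro htop
    refine h ?_
    rw [erealIntegral, htop, EReal.coe_ennreal_top]
    exact EReal.top_sub (by simpa using hneg)
  have hfin : ∀ᵐ z ∂ν, F z = (F z).toReal := by
    filter_upwards [ae_lt_top hF.ereal_toENNReal hpos] with z hz
    refine (EReal.coe_toReal ?_ ?_).symm
    · exact EReal.toENNReal_ne_top_iff.1 hz.ne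
    · exact ne_bot_of_le_ne_bot (EReal.coe_ne_bot _) (hlF z)
  refine ⟨hfin, hF.ereal_toReal.aestronglyMeasurable, ?_⟩
  rw [hasFiniteIntegral_iff_enorm]
  have hle : ∀ᵐ z ∂ν, ‖(F z).toReal‖ₑ ≤ (F z).toENNReal + (-F z).toENNReal := by
    filter_upwards [hfin] with z hz
    rw [hz, ← EReal.coe_neg, EReal.real_coe_toENNReal, EReal.real_coe_toENNReal, EReal.toReal_coe,
      Real.enorm_eq_ofReal_abs]
    rcases le_total 0 (F z).toReal with h0 | h0
    · rw [abs_of_nonneg h0]; exact le_self_add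
    · rw [abs_of_nonpos h0]; exact le_add_self
  refine (lintegral_mono_ae hle).trans_lt ?_
  rw [lintegral_add_left hF.ereal_toENNReal]
  exact ENNReal.add_lt_top.2 ⟨hpos.lt_top, hneg.lt_top⟩

/-! ### The entropic conjugate -/

section Conj

variable {d : ℕ} {σ τ : Measure (Eu d)} {ε : ℝ} {η : Eu d → EReal} {g : Eu d → ℝ}

lemma entropicConj_eq_mul_log (hη : ∀ᵐ z ∂σ, η z = g z) (x : Eu d) :
    entropicConj ε σ η x =
      ε * ENNReal.log (∫⁻ z, ENNReal.ofReal (Real.exp ((⟪z, x⟫ - g z) / ε)) ∂σ) := by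
  unfold entropicConj
  congr 2
  refine lintegral_congr_ae (hη.mono fun z hz => ?_)
  simp only [hz, ← EReal.coe_sub, ← EReal.coe_div, EReal.exp_coe]

lemma measurable_entropicConj [SFinite σ] (hg : Measurable g) (hη : ∀ᵐ z ∂σ, η z = g z) :
    Measurable (entropicConj ε σ η) := by
  have h : entropicConj ε σ η = fun x =>
      ε * ENNReal.log (∫⁻ z, ENNReal.ofReal (Real.exp ((⟪z, x⟫ - g z) / ε)) ∂σ) :=
    funext (entropicConj_eq_mul_log hη)
  rw [h]
  have hm : Measurable (fun p : Eu d × Eu d =>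
      ENNReal.ofReal (Real.exp ((⟪p.2, p.1⟫ - g p.2) / ε))) := by
    have : Measurable (fun p : Eu d × Eu d => ⟪p.2, p.1⟫) := by fun_prop
    fun_prop
  exact (Measurable.lintegral_prod_right' hm).ennreal_log.const_mul _

lemma lintegral_exp_eq_mul_lintegral_gibbs (f : Eu d → ℝ) (x : Eu d) :
    ∫⁻ z, ENNReal.ofReal (Real.exp ((⟪z, x⟫ - g z) / ε)) ∂σ =
      ENNReal.ofReal (Real.exp (f x / ε)) * ∫⁻ z, ENNReal.ofReal (gibbs ε f g x z) ∂σ := by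
  rw [← lintegral_const_mul' _ _ ENNReal.ofReal_ne_top]
  refine lintegral_congr fun z => ?_
  rw [← ENNReal.ofReal_mul (Real.exp_pos _).le, gibbs, ← Real.exp_add, real_inner_comm]
  ring_nf

/-- This excludes the value `⊥`: a conjugate with a real-valued potential is either finite or `⊤`.
-/
lemma lintegral_exp_ne_zero [NeZero σ] (hg : Measurable g) (x : Eu d) :
    ∫⁻ z, ENNReal.ofReal (Real.exp ((⟪z, x⟫ - g z) / ε)) ∂σ ≠ 0 := by
  rw [Ne, lintegral_eq_zero_iff (by fun_prop)]
  intro h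
  have : ∀ᵐ z ∂σ, False := h.mono fun z hz => by
    simp only [Pi.zero_apply, ENNReal.ofReal_eq_zero] at hz
    exact absurd hz (Real.exp_pos _).not_ge
  exact NeZero.ne σ (by simpa [ae_eq_bot] using this)

lemma entropicConj_eq_coe_of_lintegral_ne_top [NeZero σ] (hg : Measurable g)
    (hη : ∀ᵐ z ∂σ, η z = g z) {x : Eu d}
    (hx : ∫⁻ z, ENNReal.ofReal (Real.exp ((⟪z, x⟫ - g z) / ε)) ∂σ ≠ ⊤) :
    entropicConj ε σ η x = ((ε * Real.log (∫⁻ z, ENNReal.ofReal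
      (Real.exp ((⟪z, x⟫ - g z) / ε)) ∂σ).toReal : ℝ) : EReal) := by
  rw [entropicConj_eq_mul_log hη, ENNReal.log_pos_real (lintegral_exp_ne_zero hg x) hx,
    EReal.coe_mul]

lemma entropicConj_eq_top_of_lintegral_eq_top (hε : 0 < ε)
    (hη : ∀ᵐ z ∂σ, η z = g z) {x : Eu d}
    (hx : ∫⁻ z, ENNReal.ofReal (Real.exp ((⟪z, x⟫ - g z) / ε)) ∂σ = ⊤) :
    entropicConj ε σ η x = ⊤ := by
  rw [entropicConj_eq_mul_log hη, hx, ENNReal.log_top, EReal.coe_mul_top_of_pos hε]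

lemma entropicConj_eq_coe_toReal [NeZero σ] (hε : 0 < ε) (hg : Measurable g)
    (hη : ∀ᵐ z ∂σ, η z = g z) {x : Eu d} (hx : entropicConj ε σ η x ≠ ⊤) :
    entropicConj ε σ η x = (entropicConj ε σ η x).toReal := by
  rw [entropicConj_eq_coe_of_lintegral_ne_top hg hη
    (fun h => hx (entropicConj_eq_top_of_lintegral_eq_top hε hη h)), EReal.toReal_coe]

/-- Where the entropic conjugate is finite, it normalizes the Gibbs kernel. -/
lemma lintegral_gibbs_entropicConj [NeZero σ] (hε : 0 < ε) (hg : Measurable g)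
    (hη : ∀ᵐ z ∂σ, η z = g z) {x : Eu d} (hx : entropicConj ε σ η x ≠ ⊤) :
    ∫⁻ z, ENNReal.ofReal (gibbs ε (fun x => (entropicConj ε σ η x).toReal) g x z) ∂σ = 1 := by
  have hI : ∫⁻ z, ENNReal.ofReal (Real.exp ((⟪z, x⟫ - g z) / ε)) ∂σ ≠ ⊤ :=
    fun h => hx (entropicConj_eq_top_of_lintegral_eq_top hε hη h)
  have h0 := lintegral_exp_ne_zero (ε := ε) (σ := σ) hg x
  have h1 := lintegral_exp_eq_mul_lintegral_gibbs (g := g) (ε := ε) (σ := σ)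
    (fun x => (entropicConj ε σ η x).toReal) x
  have h2 : ENNReal.ofReal (Real.exp ((entropicConj ε σ η x).toReal / ε)) =
      ∫⁻ z, ENNReal.ofReal (Real.exp ((⟪z, x⟫ - g z) / ε)) ∂σ := by
    rw [entropicConj_eq_coe_of_lintegral_ne_top hg hη hI, EReal.toReal_coe,
      mul_div_cancel_left₀ _ hε.ne', Real.exp_log (ENNReal.toReal_pos h0 hI),
      ENNReal.ofReal_toReal hI]
  simp only [h2] at h1
  exact ((ENNReal.mul_eq_left h0 hI).1 h1.symm)

/-- Used with a quadratic potential, to exhibit a competitor with finite dual value. -/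
lemma entropicConj_le [IsProbabilityMeasure σ] (hε : 0 < ε) (hη : ∀ᵐ z ∂σ, η z = g z) {x : Eu d}
    {c : ℝ} (hc : ∀ z, ⟪z, x⟫ - g z ≤ c) : entropicConj ε σ η x ≤ c := by
  have h1 : ∫⁻ z, ENNReal.ofReal (Real.exp ((⟪z, x⟫ - g z) / ε)) ∂σ ≤
      ENNReal.ofReal (Real.exp (c / ε)) := by
    calc _ ≤ ∫⁻ _, ENNReal.ofReal (Real.exp (c / ε)) ∂σ := by
          refine lintegral_mono fun z => ENNReal.ofReal_le_ofReal (Real.exp_le_exp.2 ?_)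
          exact div_le_div_of_nonneg_right (hc z) hε.le
      _ = _ := by simp
  rw [entropicConj_eq_mul_log hη]
  calc _ ≤ (ε : EReal) * ENNReal.log (ENNReal.ofReal (Real.exp (c / ε))) :=
        mul_le_mul_of_nonneg_left (ENNReal.log_monotone h1) (EReal.coe_nonneg.2 hε.le)
    _ = c := by
        rw [ENNReal.log_ofReal_of_pos (Real.exp_pos _), Real.log_exp, ← EReal.coe_mul,
          mul_div_cancel₀ _ hε.ne']

lemma integrable_of_lintegral_ofReal_eq_one {X : Type*} [MeasurableSpace X] {m : Measure X}
    {F : X → ℝ} (hF : Measurable F) (h0 : ∀ x, 0 ≤ F x)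
    (h : ∫⁻ x, ENNReal.ofReal (F x) ∂m = 1) : Integrable F m ∧ ∫ x, F x ∂m = 1 := by
  constructor
  · refine ⟨hF.aestronglyMeasurable, ?_⟩
    rw [hasFiniteIntegral_iff_ofReal (Filter.Eventually.of_forall h0), h]
    exact ENNReal.one_lt_top
  · rw [integral_eq_lintegral_of_nonneg_ae (Filter.Eventually.of_forall h0)
      hF.aestronglyMeasurable, h, ENNReal.toReal_one]

/-- Jensen's inequality for the entropic conjugate. -/
lemma le_entropicConj [IsProbabilityMeasure σ] (hε : 0 < ε) (hg : Measurable g)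
    (hη : ∀ᵐ z ∂σ, η z = g z) (hgi : Integrable g σ) (hσ : Integrable (fun z : Eu d => z) σ)
    (x : Eu d) :
    ((⟪x, ∫ z, z ∂σ⟫ - ∫ z, g z ∂σ : ℝ) : EReal) ≤ entropicConj ε σ η x := by
  by_cases hx : entropicConj ε σ η x = ⊤
  · rw [hx]; exact le_top
  have h1 := lintegral_gibbs_entropicConj hε hg hη hx
  rw [entropicConj_eq_coe_toReal hε hg hη hx, EReal.coe_le_coe_iff]
  set f : Eu d → ℝ := fun x => (entropicConj ε σ η x).toReal
  obtain ⟨h2, h3⟩ := integrable_of_lintegral_ofReal_eq_one (measurable_gibbs_right hg x)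
    (fun z => (gibbs_pos ε f g x z).le) h1
  have h4 : Integrable (fun z : Eu d => ⟪x, z⟫) σ := hσ.const_inner x
  have h5 : Integrable (fun z : Eu d => ⟪x, z⟫ - f x) σ := h4.sub (integrable_const _)
  have h6 : Integrable (fun z : Eu d => ⟪x, z⟫ - f x - g z) σ := h5.sub hgi
  have h7 := integral_mono ((h6.div_const ε).add (integrable_const (1 : ℝ))) h2
    (fun z => Real.add_one_le_exp ((⟪x, z⟫ - f x - g z) / ε))
  simp only [Pi.add_apply] at h7
  rw [h3, integral_add (h6.div_const ε) (integrable_const _), integral_div, integral_sub h5 hgi,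
    integral_sub h4 (integrable_const _), integral_inner hσ] at h7
  simp only [integral_const, probReal_univ, one_smul, add_le_iff_nonpos_left] at h7
  have h8 : ⟪x, ∫ z, z ∂σ⟫ - f x - ∫ z, g z ∂σ ≤ 0 := by
    rw [div_nonpos_iff] at h7
    rcases h7 with h7 | h7
    · linarith [h7.2]
    · exact h7.1
  linarith

/-- Jensen's inequality with its equality case: `exp u - (u + 1)` is nonnegative, vanishes only
where `u = 0`, and has integral `-∫ u`. -/
lemma integral_nonpos_of_lintegral_exp_eq_one {X : Type*} [MeasurableSpace X] {m : Measure X}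
    [IsProbabilityMeasure m] {u : X → ℝ} (hu : Measurable u) (hi : Integrable u m)
    (h : ∫⁻ x, ENNReal.ofReal (Real.exp (u x)) ∂m = 1) :
    ∫ x, u x ∂m ≤ 0 ∧ (0 ≤ ∫ x, u x ∂m → u =ᵐ[m] 0) := by
  obtain ⟨h1, h2⟩ := integrable_of_lintegral_ofReal_eq_one hu.exp (fun x => (Real.exp_pos _).le) h
  have hi1 : Integrable (fun x => u x + 1) m := hi.add (integrable_const _)
  have h3 : ∫ x, (Real.exp (u x) - (u x + 1)) ∂m = -∫ x, u x ∂m := by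
    rw [integral_sub h1 hi1, h2, integral_add hi (integrable_const _)]
    simp
  have h4 : ∀ x, 0 ≤ Real.exp (u x) - (u x + 1) := fun x => by
    linarith [Real.add_one_le_exp (u x)]
  have h5 : 0 ≤ ∫ x, (Real.exp (u x) - (u x + 1)) ∂m := integral_nonneg h4
  refine ⟨by linarith, fun h0 => ?_⟩
  have h6 : ∫ x, (Real.exp (u x) - (u x + 1)) ∂m = 0 := by linarith
  rw [integral_eq_zero_iff_of_nonneg h4 (h1.sub hi1)] at h6
  filter_upwards [h6] with x hx
  by_contra hne
  have := Real.add_one_lt_exp hne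
  simp only [Pi.zero_apply] at hx
  linarith

/-- Passing to the entropic conjugate of the other potential decreases the integral of a potential
whose Gibbs kernel is normalized in the other direction, strictly unless nothing changes. -/
lemma entropicConj_improves [IsProbabilityMeasure σ] [IsProbabilityMeasure τ] (hε : 0 < ε)
    {e : Eu d → ℝ} (he : Measurable e) (hg : Measurable g) (hei : Integrable e σ)
    (hgi : Integrable g τ) (hσ : Integrable (fun x : Eu d => x) σ)
    (hτ : Integrable (fun z : Eu d => z) τ)
    (hone : ∀ᵐ z ∂τ, ∫⁻ x, ENNReal.ofReal (gibbs ε e g x z) ∂σ = 1)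
    (hη : ∀ᵐ z ∂τ, η z = g z) :
    (∀ᵐ x ∂σ, entropicConj ε τ η x ≠ ⊤) ∧
    Integrable (fun x => (entropicConj ε τ η x).toReal) σ ∧
    ∫ x, (entropicConj ε τ η x).toReal ∂σ ≤ ∫ x, e x ∂σ ∧
    (∫ x, e x ∂σ ≤ ∫ x, (entropicConj ε τ η x).toReal ∂σ →
      (fun x => (entropicConj ε τ η x).toReal) =ᵐ[σ] e) := by
  set f : Eu d → ℝ := fun x => (entropicConj ε τ η x).toReal with hf
  have hfm : Measurable f := (measurable_entropicConj hg hη).ereal_toReal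
  have hGm : Measurable (fun p : Eu d × Eu d => ENNReal.ofReal (gibbs ε e g p.1 p.2)) :=
    (measurable_gibbs he hg).ennreal_ofReal
  have hswap : ∫⁻ x, ∫⁻ z, ENNReal.ofReal (gibbs ε e g x z) ∂τ ∂σ = 1 := by
    rw [lintegral_lintegral_swap hGm.aemeasurable, lintegral_congr_ae hone]
    simp
  have hIfin : ∀ᵐ x ∂σ, ∫⁻ z, ENNReal.ofReal (gibbs ε e g x z) ∂τ < ⊤ :=
    ae_lt_top (Measurable.lintegral_prod_right' hGm) (by rw [hswap]; exact ENNReal.one_ne_top)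
  have hne : ∀ᵐ x ∂σ, entropicConj ε τ η x ≠ ⊤ := by
    filter_upwards [hIfin] with x hx
    have hI : ∫⁻ z, ENNReal.ofReal (Real.exp ((⟪z, x⟫ - g z) / ε)) ∂τ ≠ ⊤ := by
      rw [lintegral_exp_eq_mul_lintegral_gibbs e]
      exact ENNReal.mul_ne_top ENNReal.ofReal_ne_top hx.ne
    rw [entropicConj_eq_coe_of_lintegral_ne_top hg hη hI]
    exact EReal.coe_ne_top _
  -- The kernel of `(e, g)` is `exp ((f - e) / ε)` times that of `(f, g)`, whose integral in `z` is
  -- `1`; the former has total mass `1` by its other normalization.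
  have hexp : ∫⁻ x, ENNReal.ofReal (Real.exp ((f x - e x) / ε)) ∂σ = 1 := by
    rw [← hswap]
    refine lintegral_congr_ae ?_
    filter_upwards [hne] with x hx
    have h1 := lintegral_gibbs_entropicConj hε hg hη hx
    rw [← mul_one (ENNReal.ofReal _), ← h1, ← lintegral_const_mul' _ _ ENNReal.ofReal_ne_top]
    refine lintegral_congr fun z => ?_
    rw [← ENNReal.ofReal_mul (Real.exp_pos _).le, gibbs, gibbs, ← Real.exp_add]
    congr 2
    simp only [hf]
    ring
  have hum : Measurable (fun x => (f x - e x) / ε) := (hfm.sub he).div_const ε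
  have hexpi := (integrable_of_lintegral_ofReal_eq_one hum.exp
    (fun x => (Real.exp_pos _).le) hexp).1
  have hfi : Integrable f σ := by
    have hlow : Integrable (fun x : Eu d => ⟪x, ∫ z, z ∂τ⟫ - ∫ z, g z ∂τ) σ :=
      (hσ.inner_const _).sub (integrable_const _)
    -- Below, Jensen gives an affine bound; above, `t ≤ exp t` with the integrable exponential just
    -- found.
    refine integrable_of_le_of_le hfm.aestronglyMeasurable
      (g₁ := fun x : Eu d => ⟪x, ∫ z, z ∂τ⟫ - ∫ z, g z ∂τ)
      (g₂ := fun x => e x + ε * Real.exp ((f x - e x) / ε)) ?_ ?_ hlow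
      (hei.add (hexpi.const_mul ε))
    · filter_upwards [hne] with x hx
      have := le_entropicConj hε hg hη hgi hτ x
      rwa [entropicConj_eq_coe_toReal hε hg hη hx, EReal.coe_le_coe_iff] at this
    · refine Filter.Eventually.of_forall fun x => ?_
      have h1 := Real.add_one_le_exp ((f x - e x) / ε)
      have h2 : ε * ((f x - e x) / ε) = f x - e x := by field_simp
      have h3 : ε * ((f x - e x) / ε) ≤ ε * Real.exp ((f x - e x) / ε) := by
        gcongr
        linarith
      show f x ≤ e x + ε * Real.exp ((f x - e x) / ε)
      linarith
  have hfe : Integrable (fun x => f x - e x) σ := hfi.sub hei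
  obtain ⟨h1, h2⟩ := integral_nonpos_of_lintegral_exp_eq_one hum (hfe.div_const ε) hexp
  rw [integral_div, integral_sub hfi hei] at h1 h2
  refine ⟨hne, hfi, ?_, fun hle => ?_⟩
  · rw [div_le_iff₀ hε, zero_mul] at h1
    linarith
  · filter_upwards [h2 (div_nonneg (by linarith) hε.le)] with x hx
    rw [Pi.zero_apply, div_eq_zero_iff] at hx
    rcases hx with hx | hx
    · linarith
    · exact absurd hx hε.ne'

end Conj

/-! ### The Schrödinger system -/

/-- The Schrödinger system for a pair of extended-real potentials: both are almost everywhere finite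
and integrable, and the Gibbs kernel is normalized in both directions wherever the corresponding
potential is finite. -/
structure IsSchrodingerSystem {d : ℕ} (ε : ℝ) (ρ ν : Measure (Eu d)) (φ ψ : Eu d → EReal) :
    Prop where
  measurable_fst : Measurable fun x => (φ x).toReal
  measurable_snd : Measurable fun z => (ψ z).toReal
  integrable_fst : Integrable (fun x => (φ x).toReal) ρ
  integrable_snd : Integrable (fun z => (ψ z).toReal) ν
  ae_ne_top_fst : ∀ᵐ x ∂ρ, φ x ≠ ⊤
  ae_ne_top_snd : ∀ᵐ z ∂ν, ψ z ≠ ⊤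
  eq_coe_fst : ∀ x, φ x ≠ ⊤ → φ x = (φ x).toReal
  eq_coe_snd : ∀ z, ψ z ≠ ⊤ → ψ z = (ψ z).toReal
  lintegral_fst : ∀ x, φ x ≠ ⊤ → ∫⁻ z, ENNReal.ofReal
    (gibbs ε (fun x => (φ x).toReal) (fun z => (ψ z).toReal) x z) ∂ν = 1
  lintegral_snd : ∀ z, ψ z ≠ ⊤ → ∫⁻ x, ENNReal.ofReal
    (gibbs ε (fun x => (φ x).toReal) (fun z => (ψ z).toReal) x z) ∂ρ = 1

/-- Minimizers of the entropic dual solve the Schrödinger system. -/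
theorem IsEntropicPotentials.isSchrodingerSystem {d : ℕ} {ε : ℝ} (hε : 0 < ε)
    {ρ ν : Measure (Eu d)} [IsProbabilityMeasure ρ] [IsProbabilityMeasure ν]
    (hρ : MemLp (fun x : Eu d => x) 2 ρ) (hν : MemLp (fun z : Eu d => z) 2 ν)
    {φ ψ : Eu d → EReal} (h : IsEntropicPotentials ε ρ ν φ ψ) :
    IsSchrodingerSystem ε ρ ν φ ψ := by
  obtain ⟨φ₀, ⟨hφ₀, hmin⟩, hψ, hφ⟩ := h
  have hρ1 : Integrable (fun x : Eu d => x) ρ := hρ.integrable one_le_two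
  have hν1 : Integrable (fun x : Eu d => x) ν := hν.integrable one_le_two
  obtain ⟨e, hem', he_ae⟩ := hφ₀.aestronglyMeasurable
  have hem : Measurable e := hem'.measurable
  have hei : Integrable e ρ := hφ₀.congr he_ae
  have hη₀ : ∀ᵐ x ∂ρ, (φ₀ x : EReal) = e x := he_ae.mono fun x hx => by rw [hx]
  have hψm : Measurable ψ := hψ ▸ measurable_entropicConj hem hη₀
  -- the dual value is finite
  have hval : entropicDual ε ρ ν φ₀ ≠ ⊤ := by
    -- The competitor is `‖x‖² / 2`, whose conjugate is at most `‖z‖² / 2` since `⟪x, z⟫ ≤ ‖x‖² / 2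
    -- + ‖z‖² / 2`.
    have hq : Integrable (fun x : Eu d => ‖x‖ ^ 2 / 2) ρ :=
      (hρ.integrable_norm_pow two_ne_zero).div_const 2
    have hq' : Integrable (fun x : Eu d => ‖x‖ ^ 2 / 2) ν :=
      (hν.integrable_norm_pow two_ne_zero).div_const 2
    have h1 : erealIntegral ν (entropicConj ε ρ (fun x => ((‖x‖ ^ 2 / 2 : ℝ) : EReal))) ≤
        ((∫ z, ‖z‖ ^ 2 / 2 ∂ν : ℝ) : EReal) := by
      rw [← erealIntegral_coe hq' (Filter.Eventually.of_forall fun _ => rfl)]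
      refine erealIntegral_mono fun z => entropicConj_le hε
        (Filter.Eventually.of_forall fun _ => rfl) fun x => ?_
      have := norm_sub_sq_real x z
      nlinarith [sq_nonneg ‖x - z‖]
    refine ((hmin _ hq).trans (add_le_add_right h1 _)).trans_lt ?_ |>.ne
    rw [← EReal.coe_add]
    exact EReal.coe_lt_top _
  have hval' : erealIntegral ν ψ ≠ ⊤ := by
    intro htop
    refine hval ?_
    rw [entropicDual, ← hψ, htop, EReal.coe_add_top]
  have hlow : Integrable (fun z : Eu d => ⟪z, ∫ x, x ∂ρ⟫ - ∫ x, e x ∂ρ) ν :=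
    (hν1.inner_const _).sub (integrable_const _)
  obtain ⟨hψfin, hgi⟩ := integrable_toReal_of_erealIntegral_ne_top hψm hlow
    (fun z => hψ ▸ le_entropicConj hε hem hη₀ hei hρ1 z) hval'
  set g : Eu d → ℝ := fun z => (ψ z).toReal with hg
  have hgm : Measurable g := hψm.ereal_toReal
  have hψtop : ∀ᵐ z ∂ν, ψ z ≠ ⊤ := hψfin.mono fun z hz => by rw [hz]; exact EReal.coe_ne_top _
  have hone : ∀ᵐ z ∂ν, ∫⁻ x, ENNReal.ofReal (gibbs ε e g x z) ∂ρ = 1 := by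
    filter_upwards [hψtop] with z hz
    rw [hψ] at hz
    have := lintegral_gibbs_entropicConj hε hem hη₀ hz
    rw [← hψ] at this
    simpa only [gibbs_swap ε e g] using this
  obtain ⟨hφtop, hfi, hfle, hfeq⟩ := entropicConj_improves hε hem hgm hei hgi hρ1 hν1 hone hψfin
  have hφm : Measurable φ := hφ ▸ measurable_entropicConj hgm hψfin
  have hspec : ∀ x, φ x ≠ ⊤ → φ x = (φ x).toReal ∧
      ∫⁻ z, ENNReal.ofReal (gibbs ε (fun x => (φ x).toReal) g x z) ∂ν = 1 := by
    rw [hφ]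
    exact fun x hx => ⟨entropicConj_eq_coe_toReal hε hgm hψfin hx,
      lintegral_gibbs_entropicConj hε hgm hψfin hx⟩
  rw [← hφ] at hφtop hfi hfle hfeq
  set f : Eu d → ℝ := fun x => (φ x).toReal with hf
  have hfm : Measurable f := hφm.ereal_toReal
  have hone' : ∀ᵐ x ∂ρ, ∫⁻ z, ENNReal.ofReal (gibbs ε g f z x) ∂ν = 1 := by
    filter_upwards [hφtop] with x hx
    simpa only [gibbs_swap ε g f] using (hspec x hx).2
  have hrefl : ∀ᵐ x ∂ρ, ((f x : ℝ) : EReal) = f x := Filter.Eventually.of_forall fun _ => rfl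
  obtain ⟨hψ'top, hg'i, hg'le, -⟩ := entropicConj_improves hε hgm hfm hgi hfi hν1 hρ1 hone' hrefl
  -- Conjugating once more does not increase the `ν`-integral, so minimality of `φ₀` against `f`
  -- gives `∫ e ≤ ∫ f`: the equality case of the improvement.
  have hfe : f =ᵐ[ρ] e := by
    refine hfeq ?_
    have h1 := hmin f hfi
    rw [entropicDual, entropicDual, ← hψ, erealIntegral_coe hgi hψfin,
      erealIntegral_coe hg'i (hψ'top.mono fun z hz => entropicConj_eq_coe_toReal hε hfm hrefl hz),
      ← EReal.coe_add, ← EReal.coe_add, EReal.coe_le_coe_iff, integral_congr_ae he_ae] at h1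
    linarith
  -- Hence `ψ` is also the conjugate of `f`, which yields the backward normalization at every point
  -- where `ψ` is finite.
  have hη₁ : ∀ᵐ x ∂ρ, (φ₀ x : EReal) = f x := by
    filter_upwards [hη₀, hfe] with x h1 h2
    rw [h1, h2]
  refine ⟨hfm, hgm, hfi, hgi, hφtop, hψtop, fun x hx => (hspec x hx).1, fun z hz => ?_,
    fun x hx => (hspec x hx).2, fun z hz => ?_⟩
  · rw [hψ] at hz ⊢
    exact entropicConj_eq_coe_toReal hε hem hη₀ hz
  · rw [hψ] at hz
    have := lintegral_gibbs_entropicConj hε hfm hη₁ hz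
    rw [← hψ] at this
    exact (lintegral_congr fun x => by rw [gibbs_swap]).trans this

namespace IsSchrodingerSystem

variable {d : ℕ} {ε : ℝ} {ρ ν : Measure (Eu d)} {φ ψ : Eu d → EReal}

lemma isCouplingDensity (h : IsSchrodingerSystem ε ρ ν φ ψ) :
    IsCouplingDensity ρ ν (gibbs ε (fun x => (φ x).toReal) (fun z => (ψ z).toReal)) where
  measurable := measurable_gibbs h.measurable_fst h.measurable_snd
  pos := gibbs_pos _ _ _
  left := h.ae_ne_top_fst.mono h.lintegral_fst
  right := h.ae_ne_top_snd.mono h.lintegral_snd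

lemma forwardCond_eq (h : IsSchrodingerSystem ε ρ ν φ ψ) {x : Eu d} (hx : φ x ≠ ⊤) :
    forwardCond ε ν φ ψ x = ν.withDensity (fun z => ENNReal.ofReal
      (gibbs ε (fun x => (φ x).toReal) (fun z => (ψ z).toReal) x z)) := by
  refine withDensity_congr_ae ?_
  filter_upwards [h.ae_ne_top_snd] with z hz
  rw [entropicDensity, h.eq_coe_fst x hx, h.eq_coe_snd z hz, ← EReal.coe_sub, ← EReal.coe_sub,
    ← EReal.coe_div, EReal.exp_coe, gibbs]

lemma backwardCond_eq (h : IsSchrodingerSystem ε ρ ν φ ψ) {z : Eu d} (hz : ψ z ≠ ⊤) :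
    backwardCond ε ρ φ ψ z = ρ.withDensity (fun x => ENNReal.ofReal
      (gibbs ε (fun x => (φ x).toReal) (fun z => (ψ z).toReal) x z)) := by
  refine withDensity_congr_ae ?_
  filter_upwards [h.ae_ne_top_fst] with x hx
  rw [entropicDensity, h.eq_coe_fst x hx, h.eq_coe_snd z hz, ← EReal.coe_sub, ← EReal.coe_sub,
    ← EReal.coe_div, EReal.exp_coe, gibbs]

lemma forwardMap_eq (h : IsSchrodingerSystem ε ρ ν φ ψ) {x : Eu d} (hx : φ x ≠ ⊤) :
    forwardMap ε ν φ ψ x =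
      ∫ z, gibbs ε (fun x => (φ x).toReal) (fun z => (ψ z).toReal) x z • z ∂ν := by
  rw [forwardMap, h.forwardCond_eq hx, integral_withDensity_eq_integral_toReal_smul
    (measurable_gibbs_right h.measurable_snd x).ennreal_ofReal
    (Filter.Eventually.of_forall fun _ => ENNReal.ofReal_lt_top)]
  simp only [ENNReal.toReal_ofReal (gibbs_pos _ _ _ _ _).le]

lemma backwardMap_eq (h : IsSchrodingerSystem ε ρ ν φ ψ) {z : Eu d} (hz : ψ z ≠ ⊤) :
    backwardMap ε ρ φ ψ z =
      ∫ x, gibbs ε (fun x => (φ x).toReal) (fun z => (ψ z).toReal) x z • x ∂ρ := by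
  rw [backwardMap, h.backwardCond_eq hz, integral_withDensity_eq_integral_toReal_smul
    (h.isCouplingDensity.measurable_right z).ennreal_ofReal
    (Filter.Eventually.of_forall fun _ => ENNReal.ofReal_lt_top)]
  simp only [ENNReal.toReal_ofReal (gibbs_pos _ _ _ _ _).le]

lemma integrable_of_mem_forwardDomain (h : IsSchrodingerSystem ε ρ ν φ ψ) {x : Eu d}
    (hx : x ∈ forwardDomain ε ν φ ψ) :
    Integrable (fun z => gibbs ε (fun x => (φ x).toReal) (fun z => (ψ z).toReal) x z • z) ν := by
  have h1 := hx.2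
  rw [h.forwardCond_eq hx.1.ne, integrable_withDensity_iff_integrable_smul'
    (measurable_gibbs_right h.measurable_snd x).ennreal_ofReal
    (Filter.Eventually.of_forall fun _ => ENNReal.ofReal_lt_top)] at h1
  simpa only [ENNReal.toReal_ofReal (gibbs_pos _ _ _ _ _).le] using h1

lemma integrable_of_mem_backwardDomain (h : IsSchrodingerSystem ε ρ ν φ ψ) {z : Eu d}
    (hz : z ∈ backwardDomain ε ρ φ ψ) :
    Integrable (fun x => gibbs ε (fun x => (φ x).toReal) (fun z => (ψ z).toReal) x z • x) ρ := by
  have h1 := hz.2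
  rw [h.backwardCond_eq hz.1.ne, integrable_withDensity_iff_integrable_smul'
    (h.isCouplingDensity.measurable_right z).ennreal_ofReal
    (Filter.Eventually.of_forall fun _ => ENNReal.ofReal_lt_top)] at h1
  simpa only [ENNReal.toReal_ofReal (gibbs_pos _ _ _ _ _).le] using h1

end IsSchrodingerSystem

/-! ### Stability for a fixed coupling of the targets -/

/-- Pulling back along the two coordinates of `κ` places both entropic couplings on one product
space, where they can be compared. -/
lemma IsCouplingDensity.comp_map {X Y Z : Type*} [MeasurableSpace X] [MeasurableSpace Y]
    [MeasurableSpace Z] {ρ : Measure X} {μ : Measure Y} {κ : Measure Z} {G : X → Y → ℝ}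
    (h : IsCouplingDensity ρ μ G) {t : Z → Y} (ht : Measurable t) (hκ : κ.map t = μ) :
    IsCouplingDensity ρ κ (fun x b => G x (t b)) where
  measurable := h.measurable.comp (measurable_fst.prodMk (ht.comp measurable_snd))
  pos x b := h.pos x (t b)
  left := h.left.mono fun x hx => by
    rwa [← hκ, lintegral_map (h.measurable_left x).ennreal_ofReal ht] at hx
  right := ae_of_ae_map ht.aemeasurable (by rw [hκ]; exact h.right)

/-- Conditional expectation is a contraction of `L²`. -/
lemma IsCouplingDensity.lintegral_sq_condMean_le {X Y E : Type*} [MeasurableSpace X]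
    [MeasurableSpace Y] [NormedAddCommGroup E] [InnerProductSpace ℝ E] [CompleteSpace E]
    {ρ : Measure X} {κ : Measure Y} [IsFiniteMeasure ρ] [IsFiniteMeasure κ] {G : X → Y → ℝ}
    (hG : IsCouplingDensity ρ κ G) {v : Y → E} (hv : MemLp v 2 κ) :
    ∫⁻ x, ‖∫ b, G x b • v b ∂κ‖ₑ ^ 2 ∂ρ ≤ ENNReal.ofReal (∫ b, ‖v b‖ ^ 2 ∂κ) := by
  have hsq : Integrable (fun b => ‖v b‖ ^ 2) κ := hv.integrable_norm_pow two_ne_zero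
  have hGv := hG.integrable_smul_snd (hv.integrable one_le_two)
  have hGsq := hG.integrable_smul_snd hsq
  have hpt : ∀ᵐ x ∂ρ, ‖∫ b, G x b • v b ∂κ‖ ^ 2 ≤ ∫ b, G x b • ‖v b‖ ^ 2 ∂κ := by
    filter_upwards [hG.left, hGv.prod_right_ae, hGsq.prod_right_ae] with x h1 h2 h3
    obtain ⟨h4, h5⟩ := integrable_of_lintegral_ofReal_eq_one (hG.measurable_left x)
      (fun b => (hG.pos x b).le) h1
    -- Average `⟪h, v⟫ ≤ ‖v‖² / 2 + ‖h‖² / 2` under the conditional law, then optimize over `h`.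
    refine (norm_sq_le_of_forall_inner_le (k := (∫ b, G x b • ‖v b‖ ^ 2 ∂κ) / 2) zero_le_one
      fun h => ?_).trans_eq (by ring)
    rw [← integral_inner h2]
    have h6 := integral_mono (h2.const_inner h) ((h3.div_const 2).add (h4.mul_const (1 / 2 * ‖h‖ ^ 2)))
      (fun b => by
        have h7 := real_inner_le_norm h (v b)
        have h8 : ⟪h, v b⟫ ≤ ‖v b‖ ^ 2 / 2 + 1 / 2 * ‖h‖ ^ 2 := by
          nlinarith [sq_nonneg (‖h‖ - ‖v b‖)]
        have h9 := mul_le_mul_of_nonneg_left h8 (hG.pos x b).le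
        simp only [inner_smul_right, Pi.add_apply, smul_eq_mul]
        linarith)
    simp only [Pi.add_apply] at h6
    rwa [integral_add (h3.div_const 2) (h4.mul_const _), integral_div, integral_mul_const, h5,
      one_mul] at h6
  calc ∫⁻ x, ‖∫ b, G x b • v b ∂κ‖ₑ ^ 2 ∂ρ
      ≤ ∫⁻ x, ENNReal.ofReal (∫ b, G x b • ‖v b‖ ^ 2 ∂κ) ∂ρ := by
        refine lintegral_mono_ae ?_
        filter_upwards [hpt] with x hx
        rw [← ofReal_norm, ← ENNReal.ofReal_pow (norm_nonneg _)]
        exact ENNReal.ofReal_le_ofReal hx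
    _ = ENNReal.ofReal (∫ x, ∫ b, G x b • ‖v b‖ ^ 2 ∂κ ∂ρ) := by
        refine (ofReal_integral_eq_lintegral_ofReal hGsq.integral_prod_left ?_).symm
        filter_upwards [hpt] with x hx
        exact (sq_nonneg _).trans hx
    _ = _ := by rw [← integral_prod _ hGsq, hG.integral_smul_snd hsq]

lemma eLpNorm_two_le_of_lintegral_sq_le {X E : Type*} [MeasurableSpace X] [NormedAddCommGroup E]
    {ρ : Measure X} {F : X → E} {c : ℝ} (hc : 0 ≤ c) {W : ℝ≥0∞}
    (h : ∫⁻ x, ‖F x‖ₑ ^ 2 ∂ρ ≤ ENNReal.ofReal (c ^ 2) * W) :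
    eLpNorm F 2 ρ ≤ ENNReal.ofReal c * W ^ (1 / 2 : ℝ) := by
  rw [eLpNorm_eq_lintegral_rpow_enorm_toReal two_ne_zero ENNReal.ofNat_ne_top]
  simp only [ENNReal.toReal_ofNat, ENNReal.rpow_ofNat]
  refine (ENNReal.rpow_le_rpow h (by positivity)).trans_eq ?_
  rw [ENNReal.mul_rpow_of_nonneg _ _ (by positivity), ENNReal.ofReal_pow hc,
    ← ENNReal.rpow_natCast, ← ENNReal.rpow_mul]
  norm_num

/-- The stability estimate for a fixed coupling of the target measures, under exponential moment
bounds for the conditional laws of the second entropic coupling. -/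
theorem eLpNorm_forwardMap_sub_le {d : ℕ} {ρ μ ν : Measure (Eu d)}
    [IsProbabilityMeasure ρ] [IsProbabilityMeasure μ] [IsProbabilityMeasure ν]
    (hρ : MemLp (fun x : Eu d => x) 2 ρ) (hμ : MemLp (fun y : Eu d => y) 2 μ)
    (hν : MemLp (fun z : Eu d => z) 2 ν) {ε : ℝ} (hε : 0 < ε)
    {φμ ψμ φν ψν : Eu d → EReal} (Hμ : IsSchrodingerSystem ε ρ μ φμ ψμ)
    (Hν : IsSchrodingerSystem ε ρ ν φν ψν) {Λ : ℝ≥0}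
    (hTdom : forwardDomain ε ν φν ψν = Set.univ)
    (hTlip : LipschitzWith Λ (forwardMap ε ν φν ψν)) {B : ℝ} (hB : 0 ≤ B)
    (hS : ∀ᵐ z ∂ν, ∀ h : Eu d, ∫⁻ x, ENNReal.ofReal
      (gibbs ε (fun x => (φν x).toReal) (fun z => (ψν z).toReal) x z * Real.exp ⟪h, x⟫) ∂ρ ≤
      ENNReal.ofReal (Real.exp (⟪h, ∫ x, gibbs ε (fun x => (φν x).toReal)
        (fun z => (ψν z).toReal) x z • x ∂ρ⟫ + B / 2 * ‖h‖ ^ 2)))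
    {κ : Measure (Eu d × Eu d)} (hκ : IsCoupling κ μ ν) :
    eLpNorm (fun x => forwardMap ε μ φμ ψμ x - forwardMap ε ν φν ψν x) 2 ρ ≤
      ENNReal.ofReal (1 + 2 * Real.sqrt (Λ * B / ε)) *
        (∫⁻ p, ‖p.1 - p.2‖ₑ ^ 2 ∂κ) ^ (1 / 2 : ℝ) := by
  obtain ⟨hκ1, hκ2⟩ := hκ
  have : IsProbabilityMeasure κ := by
    constructor
    have := measure_univ (μ := μ)
    rwa [← hκ1, Measure.map_apply measurable_fst .univ, Set.preimage_univ] at this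
  have hm1 : MemLp (fun b : Eu d × Eu d => b.1) 2 κ := by
    rw [← hκ1] at hμ
    exact hμ.comp_of_map measurable_fst.aemeasurable
  have hm2 : MemLp (fun b : Eu d × Eu d => b.2) 2 κ := by
    rw [← hκ2] at hν
    exact hν.comp_of_map measurable_snd.aemeasurable
  have hm : MemLp (fun b : Eu d × Eu d => b.1 - b.2) 2 κ := hm1.sub hm2
  set fμ : Eu d → ℝ := fun x => (φμ x).toReal
  set gμ : Eu d → ℝ := fun x => (ψμ x).toReal
  set fν : Eu d → ℝ := fun x => (φν x).toReal
  set gν : Eu d → ℝ := fun x => (ψν x).toReal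
  set W : ℝ≥0∞ := ∫⁻ p, ‖p.1 - p.2‖ₑ ^ 2 ∂κ with hW
  have hWD : W = ENNReal.ofReal (∫ b, ‖b.1 - b.2‖ ^ 2 ∂κ) := by
    rw [ofReal_integral_eq_lintegral_ofReal (hm.integrable_norm_pow two_ne_zero)
      (Filter.Eventually.of_forall fun _ => sq_nonneg _)]
    simp only [ENNReal.ofReal_pow (norm_nonneg _), ofReal_norm, hW]
  have hp : IsCouplingDensity ρ κ (fun x b => gibbs ε fμ gμ x b.1) :=
    Hμ.isCouplingDensity.comp_map measurable_fst hκ1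
  have hq : IsCouplingDensity ρ κ (fun x b => gibbs ε fν gν x b.2) :=
    Hν.isCouplingDensity.comp_map measurable_snd hκ2
  have hxdom : ∀ x, x ∈ forwardDomain ε ν φν ψν := fun x => hTdom ▸ Set.mem_univ x
  have hTeq : forwardMap ε ν φν ψν = fun x => ∫ z, gibbs ε fν gν x z • z ∂ν :=
    funext fun x => Hν.forwardMap_eq (hxdom x).1.ne
  have hu : Integrable (fun x => fν x - fμ x) ρ := Hν.integrable_fst.sub Hμ.integrable_fst
  have hw : Integrable (fun b : Eu d × Eu d => gν b.2 - gμ b.1) κ := by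
    have h1 := Hμ.integrable_snd
    have h2 := Hν.integrable_snd
    rw [← hκ1] at h1
    rw [← hκ2] at h2
    exact (h2.comp_measurable measurable_snd).sub (h1.comp_measurable measurable_fst)
  have hcore := lintegral_sq_condMean_sub_le hp hq hε hu hw
    (fun x b => by
      simp only [gibbs]
      rw [← Real.exp_sub, Real.log_exp, inner_sub_right]
      field_simp
      ring) hρ hm1 hm2 (T := forwardMap ε ν φν ψν)
    (S := fun b => ∫ x, gibbs ε fν gν x b.2 • x ∂ρ) (A := Λ * ε) (B := B) (by positivity)
    (Filter.Eventually.of_forall fun x h => by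
      have h1 := lintegral_gibbs_mul_exp_le_of_lipschitz hε Hν.measurable_snd
        (fun x => Hν.lintegral_fst x (hxdom x).1.ne)
        (fun x => Hν.integrable_of_mem_forwardDomain (hxdom x)) (hTeq ▸ hTlip) x h
      have h2 : ∫⁻ b, ENNReal.ofReal (gibbs ε fν gν x b.2 * Real.exp ⟪h, b.2⟫) ∂κ =
          ∫⁻ z, ENNReal.ofReal (gibbs ε fν gν x z * Real.exp ⟪h, z⟫) ∂ν := by
        rw [← hκ2, lintegral_map _ measurable_snd]
        exact ((measurable_gibbs_right Hν.measurable_snd x).mul (by fun_prop)).ennreal_ofReal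
      rw [h2, hTeq]
      exact h1)
    (Filter.Eventually.of_forall fun _ => rfl)
    (ae_of_ae_map measurable_snd.aemeasurable (by rw [hκ2]; exact hS))
  -- The intermediate map: the mean of `z` given `x` when the entropic coupling of `ρ` and `μ` is
  -- glued to `κ` along `y`.
  set Q : Eu d → Eu d := fun x => ∫ b, gibbs ε fμ gμ x b.1 • b.2 ∂κ with hQ
  have hQm : AEStronglyMeasurable Q ρ :=
    (hp.integrable_smul_snd (hm2.integrable one_le_two)).integral_prod_left.aestronglyMeasurable
  have hdiff : ∀ᵐ x ∂ρ, forwardMap ε μ φμ ψμ x - Q x =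
      ∫ b, gibbs ε fμ gμ x b.1 • (b.1 - b.2) ∂κ := by
    filter_upwards [Hμ.ae_ne_top_fst,
      (hp.integrable_smul_snd (hm1.integrable one_le_two)).prod_right_ae,
      (hp.integrable_smul_snd (hm2.integrable one_le_two)).prod_right_ae] with x h1 h2 h3
    rw [Hμ.forwardMap_eq h1, ← hκ1, integral_map measurable_fst.aemeasurable, hQ]
    · simp only [smul_sub]
      rw [integral_sub h2 h3]
    · exact ((measurable_gibbs_right Hμ.measurable_snd x).smul measurable_id).aestronglyMeasurable
  have hdm : AEStronglyMeasurable (fun x => forwardMap ε μ φμ ψμ x - Q x) ρ := by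
    refine AEStronglyMeasurable.congr (hp.integrable_smul_snd
      (hm.integrable one_le_two)).integral_prod_left.aestronglyMeasurable ?_
    filter_upwards [hdiff] with x hx
    rw [hx]
  have hfirst : eLpNorm (fun x => forwardMap ε μ φμ ψμ x - Q x) 2 ρ ≤
      ENNReal.ofReal 1 * W ^ (1 / 2 : ℝ) := by
    refine eLpNorm_two_le_of_lintegral_sq_le zero_le_one ?_
    rw [one_pow, ENNReal.ofReal_one, one_mul, hWD]
    refine le_trans (le_of_eq ?_) (hp.lintegral_sq_condMean_le hm)
    refine lintegral_congr_ae ?_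
    filter_upwards [hdiff] with x hx
    rw [hx]
  have hsecond : eLpNorm (fun x => Q x - forwardMap ε ν φν ψν x) 2 ρ ≤
      ENNReal.ofReal (2 * Real.sqrt (Λ * B / ε)) * W ^ (1 / 2 : ℝ) := by
    refine eLpNorm_two_le_of_lintegral_sq_le (by positivity) ?_
    refine hcore.trans_eq ?_
    -- With `A = Λ ε`, the constant `4 A B / ε²` is the square of `2 √(Λ B / ε)`.
    rw [hWD, ← ENNReal.ofReal_mul (sq_nonneg _), mul_pow, Real.sq_sqrt (by positivity)]
    congr 2
    field_simp
    ring
  have hsum : (fun x => forwardMap ε μ φμ ψμ x - forwardMap ε ν φν ψν x) =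
      (fun x => forwardMap ε μ φμ ψμ x - Q x) + fun x => Q x - forwardMap ε ν φν ψν x := by
    funext x
    simp only [Pi.add_apply, sub_add_sub_cancel]
  rw [hsum]
  refine (eLpNorm_add_le hdm (hQm.sub hTlip.continuous.aestronglyMeasurable) one_le_two).trans ?_
  refine (add_le_add hfirst hsecond).trans_eq ?_
  rw [← add_mul, ← ENNReal.ofReal_add zero_le_one (by positivity)]

/-! ### Infimum over couplings and conclusion -/

/-- Scaling by a positive finite constant and the square root can both be inverted, so the bound
passes to the infimum without an optimal coupling. -/
lemma le_mul_wasserstein2 {d : ℕ} {μ ν : Measure (Eu d)} {X : ℝ≥0∞} {c : ℝ} (hc : 0 < c)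
    (h : ∀ κ : Measure (Eu d × Eu d), IsCoupling κ μ ν →
      X ≤ ENNReal.ofReal c * (∫⁻ p, ‖p.1 - p.2‖ₑ ^ 2 ∂κ) ^ (1 / 2 : ℝ)) :
    X ≤ ENNReal.ofReal c * wasserstein2 μ ν := by
  have hc0 : ENNReal.ofReal c ≠ 0 := (ENNReal.ofReal_pos.2 hc).ne'
  have hdiv : ∀ Y, X ≤ ENNReal.ofReal c * Y ↔ X / ENNReal.ofReal c ≤ Y := fun Y => by
    rw [ENNReal.div_le_iff' hc0 ENNReal.ofReal_ne_top]
  have hpow : ∀ Y : ℝ≥0∞, X / ENNReal.ofReal c ≤ Y ^ (1 / 2 : ℝ) ↔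
      (X / ENNReal.ofReal c) ^ (2 : ℝ) ≤ Y := fun Y => by
    rw [one_div, ENNReal.le_rpow_inv_iff two_pos]
  rw [hdiv, wasserstein2, hpow]
  exact le_iInf₂ fun κ hκ => (hpow _).1 ((hdiv _).1 (h κ hκ))

theorem corollary3p5 {d : ℕ} (ρ μ ν : Measure (Eu d))
    [IsProbabilityMeasure ρ] [IsProbabilityMeasure μ] [IsProbabilityMeasure ν]
    (hρ : MemLp (fun x : Eu d => x) 2 ρ) (hμ : MemLp (fun y : Eu d => y) 2 μ)
    (hν : MemLp (fun z : Eu d => z) 2 ν)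
    (ε : ℝ) (hε : 0 < ε)
    (φμ ψμ φν ψν : Eu d → EReal)
    (hpotμ : IsEntropicPotentials ε ρ μ φμ ψμ)
    (hpotν : IsEntropicPotentials ε ρ ν φν ψν)
    (Λ : ℝ≥0)
    (hTdom : forwardDomain ε ν φν ψν = Set.univ)
    (hTlip : LipschitzWith Λ (forwardMap ε ν φν ψν)) :
    (∀ R : ℝ, ρ (Metric.closedBall 0 R)ᶜ = 0 →
      eLpNorm (fun x => forwardMap ε μ φμ ψμ x - forwardMap ε ν φν ψν x) 2 ρ ≤
        ENNReal.ofReal (1 + 2 * Real.sqrt (Λ * R ^ 2 / ε)) * wasserstein2 μ ν) ∧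
    (∀ lam : ℝ≥0, 0 < lam →
      backwardDomain ε ρ φν ψν = Set.univ →
      LipschitzWith (1 / lam) (backwardMap ε ρ φν ψν) →
      eLpNorm (fun x => forwardMap ε μ φμ ψμ x - forwardMap ε ν φν ψν x) 2 ρ ≤
        ENNReal.ofReal (1 + 2 * Real.sqrt (Λ / lam)) * wasserstein2 μ ν) := by
  have Hμ := hpotμ.isSchrodingerSystem hε hρ hμ
  have Hν := hpotν.isSchrodingerSystem hε hρ hν
  refine ⟨fun R hR => ?_, fun lam hlam hSdom hSlip => ?_⟩
  · refine le_mul_wasserstein2 (by positivity) fun κ hκ => ?_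
    refine eLpNorm_forwardMap_sub_le hρ hμ hν hε Hμ Hν hTdom hTlip (sq_nonneg R) ?_ hκ
    have hint := (Hν.isCouplingDensity.integrable_smul_fst
      (hρ.integrable one_le_two)).prod_left_ae
    filter_upwards [Hν.isCouplingDensity.right, hint] with z h1 h2 h
    exact lintegral_mul_exp_le_of_ball (fun x => gibbs_pos _ _ _ _ _)
      (Hν.isCouplingDensity.measurable_right z) h1 hR h2 h
  · have hlam' : (0 : ℝ) < lam := hlam
    refine le_mul_wasserstein2 (by positivity) fun κ hκ => ?_
    have hzdom : ∀ z, z ∈ backwardDomain ε ρ φν ψν := fun z => hSdom ▸ Set.mem_univ z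
    have hSeq : backwardMap ε ρ φν ψν = fun z => ∫ x, gibbs ε (fun z => (ψν z).toReal)
        (fun x => (φν x).toReal) z x • x ∂ρ :=
      funext fun z => by
        rw [Hν.backwardMap_eq (hzdom z).1.ne]
        simp only [gibbs_swap ε (fun x => (φν x).toReal)]
    -- Exchanging the two potentials turns the backward kernel into a Gibbs kernel based at `z`, so
    -- the Lipschitz criterion applies to it and gives `B = ε / λ`.
    have hkey := eLpNorm_forwardMap_sub_le hρ hμ hν hε Hμ Hν hTdom hTlip
      (B := ((1 / lam : ℝ≥0) : ℝ) * ε) (by positivity)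
      (Filter.Eventually.of_forall fun z h => by
        simp only [gibbs_swap ε (fun x => (φν x).toReal)]
        refine lintegral_gibbs_mul_exp_le_of_lipschitz hε Hν.measurable_fst (fun z => ?_)
          (fun z => ?_) (hSeq ▸ hSlip) z h
        · simpa only [gibbs_swap ε (fun x => (φν x).toReal)] using
            Hν.lintegral_snd z (hzdom z).1.ne
        · simpa only [gibbs_swap ε (fun x => (φν x).toReal)] using
            Hν.integrable_of_mem_backwardDomain (hzdom z)) hκ
    have hconst : (Λ : ℝ) * (((1 / lam : ℝ≥0) : ℝ) * ε) / ε = Λ / lam := by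
      push_cast
      field_simp
    rwa [hconst] at hkey
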